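/- Let $d,n\in\mathbb N$ with $n\ge 1$, let $x_1,\dots,x_n\in\mathbb R^d$ be points with labels $y_1,\dots,y_n\in\{-1,1\}$, let $\ell:\mathbb R\to[0,\infty)$ be a nondecreasing loss function, $r:\mathbb R^d\to[0,\infty)$ a regularizer, $\lambda>0$, and $R=\max_i\|x_i\|_2$. For $\beta\in\mathbb R^d$ put $$f_i(\beta)=\ell(-y_i\,\beta\cdot x_i)+\frac{\lambda\, r(R\beta)}{n},$$ so that $\sum_{i=1}^n f_i(\beta)=F(\beta)=\sum_{i=1}^n\ell(-y_i\,\beta\cdot x_i)+\lambda\, r(R\beta)$ is the objective. A finite collection $C$ of indices from $\{1,\dots,n\}$ (repetitions allowed) with weights $u_i\ge 0$ $(i\in C)$ is an $\varepsilon$-coreset if for all $\beta\in\mathbb R^d$ $$\frac{\bigl|\sum_{i=1}^n f_i(\beta)-\sum_{i\in C}u_if_i(\beta)\bigr|}{\sum_{i=1}^n f_i(\beta)}\le\varepsilon .$$ A finite set $A\subset\mathbb R^d$ is shatterable by $\ell$ if for every $B\subseteq A$ there are $\beta\in\mathbb R^d$ and $t\in\mathbb R$ with $\ell(\beta\cdot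 x)\ge t$ for $x\in B$ and $\ell(\beta\cdot x)<t$ for $x\in A\setminus B$; the VC-dimension of $\ell$ (on $\mathbb R^d$) is the maximum cardinality of a shatterable set. Let $\sigma\ge 0$ and $\tau>0$ be such that $\ell$ and $r$ satisfy the $(\sigma,\tau)$-scaling condition: $\ell(-\sigma)>0$, and $r(\beta)\ge\tau\,\ell(\|\beta\|_2)$ for all $\beta\in\mathbb R^d$ with $\|\beta\|_2\ge\sigma$. Suppose that $\ell$ has VC-dimension at most $\Delta\in\mathbb N$, let $\varepsilon,\delta\in(0,1)$, and set $$S'=\frac{n}{\tau\lambda}+\frac{\ell(\sigma)}{\ell(-\sigma)}+1,\qquad q=\frac{10S'}{\varepsilon^2}\Bigl(\Delta\log S'+\log\frac1\delta\Bigr).$$ Then for every integer $m\ge q$, a sample of $m$ indices drawn independently and uniformly at random from $\{1,\dots,n\}$, each given the weight $n/m$, is an $\varepsilon$-coreset with probability at least $1-\delta$. -/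

import Mathlib

open MeasureTheory

noncomputable section

/-- An instance of the regularized loss minimization problem: `n` points in `ℝ^d` with labels
in `{-1, 1}`, a nonnegative nondecreasing loss `loss`, a nonnegative regularizer `reg` and a
regularization parameter `lam > 0`. -/
structure RLMInstance (d n : ℕ) where
  x : Fin n → EuclideanSpace ℝ (Fin d)
  y : Fin n → ℝ
  y_label : ∀ i, y i = -1 ∨ y i = 1
  loss : ℝ → ℝ
  loss_nonneg : ∀ z, 0 ≤ loss z
  loss_mono : Monotone loss
  reg : EuclideanSpace ℝ (Fin d) → ℝ
  reg_nonneg : ∀ β, 0 ≤ reg β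
  lam : ℝ
  lam_pos : 0 < lam

/-- The maximum Euclidean norm of a data point. -/
def RLMInstance.R {d n : ℕ} [NeZero n] (I : RLMInstance d n) : ℝ :=
  Finset.univ.sup' Finset.univ_nonempty (fun i : Fin n => ‖I.x i‖)

/-- `f_i(β) = ℓ(-y_i β·x_i) + λ r(Rβ) / n`, the contribution of point `i` to the objective
`F(β) = ∑ i, ℓ(-y_i β·x_i) + λ r(Rβ)`. -/
def RLMInstance.f {d n : ℕ} [NeZero n] (I : RLMInstance d n) (i : Fin n)
    (β : EuclideanSpace ℝ (Fin d)) : ℝ :=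
  I.loss (-I.y i * inner ℝ β (I.x i)) + I.lam * I.reg (I.R • β) / n

/-- The relative error `H(β)` of a weighted subcollection, given as a list `C` of `m` indices
(repetitions allowed) with weights `u`. -/
def RLMInstance.relError {d n m : ℕ} [NeZero n] (I : RLMInstance d n) (C : Fin m → Fin n)
    (u : Fin m → ℝ) (β : EuclideanSpace ℝ (Fin d)) : ℝ :=
  |∑ i, I.f i β - ∑ j, u j * I.f (C j) β| / ∑ i, I.f i β

/-- `(C, u)` is an `ε`-coreset of the instance. -/
def RLMInstance.IsCoreset {d n m : ℕ} [NeZero n] (I : RLMInstance d n) (ε : ℝ)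
    (C : Fin m → Fin n) (u : Fin m → ℝ) : Prop :=
  (∀ j, 0 ≤ u j) ∧ ∀ β, I.relError C u β ≤ ε

/-- A finite set `A` of points of `ℝ^d` is shatterable by the loss: every labelling (`B` is the
set of positively labelled points) is realized by some hypothesis and some threshold. -/
def LossShatters {d : ℕ} (loss : ℝ → ℝ) (A : Finset (EuclideanSpace ℝ (Fin d))) : Prop :=
  ∀ B ⊆ A, ∃ (β : EuclideanSpace ℝ (Fin d)) (t : ℝ),
    ∀ x ∈ A, (x ∈ B → t ≤ loss (inner ℝ β x)) ∧ (x ∉ B → loss (inner ℝ β x) < t)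

/-- The VC-dimension of a loss function on `ℝ^d`. -/
def lossVCDim (d : ℕ) (loss : ℝ → ℝ) : ℕ∞ :=
  ⨆ (A : Finset (EuclideanSpace ℝ (Fin d))) (_ : LossShatters loss A), (A.card : ℕ∞)

/-- The `(σ, τ)`-scaling condition. -/
def ScalingCondition {d : ℕ} (loss : ℝ → ℝ) (reg : EuclideanSpace ℝ (Fin d) → ℝ)
    (σ τ : ℝ) : Prop :=
  0 < loss (-σ) ∧ ∀ β : EuclideanSpace ℝ (Fin d), σ ≤ ‖β‖ → τ * loss ‖β‖ ≤ reg β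

/-- The law of `m` i.i.d. uniform draws from the `n` indices. -/
def uniformSample (n m : ℕ) [NeZero n] : Measure (Fin m → Fin n) :=
  Measure.pi (fun _ : Fin m => (PMF.uniformOfFintype (Fin n)).toMeasure)

end

/-!
It suffices that the sample approximates the density of every superlevel set of
`i ↦ ℓ(-y_i β·x_i)` up to an error `ε (ν + density)`: integrating over the threshold, the error for
the mean loss is at most `ε (ν (hi - lo) + mean - lo)` whenever all losses at `β` lie in `[lo, hi]`.
The scaling condition provides such an interval with `ν (hi - lo) ≤ lo + λ r(Rβ) / n`, where `ν` is
of order `1 / S'`: for `‖Rβ‖ ≥ σ` the regularizer pays for `hi`, and otherwise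
`[ℓ(-σ), ℓ(σ)]` will do.

The superlevel sets have VC-dimension at most `Δ`, so what remains is a uniform relative deviation
bound of Li, Long and Srinivasan. Compare the sample with a ghost sample, interchange the members of
each pair at random, and chain through nets whose sizes are controlled by Haussler's packing lemma.
The tilt that measures deviations relative to the density makes the exponential moment of each
single set small. Large `ε` needs no chaining: there the Sauer-Shelah bound is enough.
-/

open Finset
open scoped BigOperators symmDiff

theorem sum_choose_le_exp_mul_div_pow {k D : ℕ} (hD : 1 ≤ D) (hDk : D ≤ k) :
    ((∑ i ∈ Iic D, k.choose i : ℕ) : ℝ) ≤ (Real.exp 1 * k / D) ^ D := by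
  have : (0 : ℝ) < D := by exact_mod_cast hD
  have hk0 : (0 : ℝ) < k := by exact_mod_cast hD.trans hDk
  set r : ℝ := D / k with hr
  have hr0 : 0 < r := by positivity
  have hr1 : r ≤ 1 := div_le_one_of_le₀ (by exact_mod_cast hDk) hk0.le
  have hpow : (Real.exp 1 * k / D) ^ D = Real.exp r ^ k / r ^ D := by
    rw [← Real.exp_nat_mul, hr, mul_div_cancel₀ _ hk0.ne', div_pow, mul_pow, ← Real.exp_nat_mul,
      mul_one, div_pow, div_div_eq_mul_div]
  rw [hpow, le_div_iff₀ (by positivity), Nat.cast_sum, sum_mul]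
  calc ∑ i ∈ Iic D, (k.choose i : ℝ) * r ^ D
      ≤ ∑ i ∈ Iic D, r ^ i * 1 ^ (k - i) * (k.choose i : ℝ) := by
        refine sum_le_sum fun i hi => ?_
        rw [one_pow, mul_one, mul_comm]
        exact mul_le_mul_of_nonneg_right (pow_le_pow_of_le_one hr0.le hr1 (mem_Iic.1 hi))
          (Nat.cast_nonneg _)
    _ ≤ ∑ i ∈ range (k + 1), r ^ i * 1 ^ (k - i) * (k.choose i : ℝ) := by
        refine sum_le_sum_of_subset_of_nonneg (fun i hi => ?_) fun i _ _ => by positivity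
        exact mem_range.2 (Nat.lt_succ_of_le ((mem_Iic.1 hi).trans hDk))
    _ = (r + 1) ^ k := (add_pow r 1 k).symm
    _ ≤ Real.exp r ^ k := by gcongr; exact Real.add_one_le_exp r

theorem card_le_exp_mul_div_pow_of_vcDim_le {ι : Type*} [Fintype ι] [DecidableEq ι]
    {𝒜 : Finset (Finset ι)} {D : ℕ} (h𝒜 : 𝒜.vcDim ≤ D) (hD : 1 ≤ D) (hDι : D ≤ Fintype.card ι) :
    (#𝒜 : ℝ) ≤ (Real.exp 1 * Fintype.card ι / D) ^ D := by
  refine le_trans ?_ (sum_choose_le_exp_mul_div_pow hD hDι)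
  exact_mod_cast (card_le_card_shatterer 𝒜).trans (card_shatterer_le_sum_vcDim.trans
    (sum_le_sum_of_subset (Iic_subset_Iic.2 h𝒜)))

section SetFamily

variable {ι κ : Type*} [Fintype ι] [DecidableEq κ]

/-- The preimage of a finite set under a map from a finite type. If `φ` is regarded as a list of
points indexed by `ι`, this is the trace of `A` on the list. -/
def comapFinset (φ : ι → κ) (A : Finset κ) : Finset ι :=
  {i | φ i ∈ A}

@[simp]
theorem mem_comapFinset {φ : ι → κ} {A : Finset κ} {i : ι} : i ∈ comapFinset φ A ↔ φ i ∈ A := by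
  simp [comapFinset]

theorem comapFinset_filter [Fintype κ] (φ : ι → κ) (p : κ → Prop) [DecidablePred p] :
    comapFinset φ ({k | p k} : Finset κ) = ({i | p (φ i)} : Finset ι) := by
  simp [comapFinset]

variable [DecidableEq ι]

/-- The family of the preimages under `φ` of the members of a set family. -/
def comapFamily (φ : ι → κ) (𝒜 : Finset (Finset κ)) : Finset (Finset ι) :=
  𝒜.image (comapFinset φ)

theorem injOn_of_shatters_comapFamily {φ : ι → κ} {𝒜 : Finset (Finset κ)} {s : Finset ι}
    (hs : (comapFamily φ 𝒜).Shatters s) : Set.InjOn φ s := by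
  intro a ha b hb hab
  obtain ⟨u, hu, hsu⟩ := hs (singleton_subset_iff.2 ha)
  obtain ⟨A, -, rfl⟩ := mem_image.1 hu
  have hmem : ∀ i ∈ s, (φ i ∈ A ↔ i = a) := fun i hi => by
    simpa [mem_coe.1 hi] using congrArg (i ∈ ·) hsu
  exact ((hmem b hb).1 (hab ▸ (hmem a ha).2 rfl)).symm

theorem shatters_image_of_comapFamily {φ : ι → κ} {𝒜 : Finset (Finset κ)} {s : Finset ι}
    (hs : (comapFamily φ 𝒜).Shatters s) : 𝒜.Shatters (s.image φ) := by
  intro t ht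
  obtain ⟨u, hu, hsu⟩ := hs (filter_subset (fun i => φ i ∈ t) s)
  obtain ⟨A, hA, rfl⟩ := mem_image.1 hu
  have hmem : ∀ i ∈ s, (φ i ∈ A ↔ φ i ∈ t) := fun i hi => by
    simpa [hi] using congrArg (i ∈ ·) hsu
  refine ⟨A, hA, ext fun x => ⟨fun hx => ?_, fun hx => ?_⟩⟩
  · obtain ⟨⟨i, hi, rfl⟩, hxA⟩ := by simpa only [mem_inter, mem_image] using hx
    exact (hmem i hi).1 hxA
  · obtain ⟨i, hi, rfl⟩ := mem_image.1 (ht hx)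
    exact mem_inter.2 ⟨ht hx, (hmem i hi).2 hx⟩

theorem vcDim_comapFamily_le (φ : ι → κ) (𝒜 : Finset (Finset κ)) :
    (comapFamily φ 𝒜).vcDim ≤ 𝒜.vcDim := by
  refine Finset.sup_le fun s hs => ?_
  rw [mem_shatterer] at hs
  rw [← card_image_of_injOn (injOn_of_shatters_comapFamily hs)]
  exact (shatters_image_of_comapFamily hs).card_le_vcDim

end SetFamily

section Packing

variable {κ : Type*} [Fintype κ] [DecidableEq κ]

theorem dens_comapFinset_eq_le {ι : Type*} [Fintype ι] [DecidableEq ι] [Nonempty κ]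
    {A B : Finset κ} {ρ : ℝ} (hAB : ρ ≤ (A ∆ B).dens) :
    (({φ | comapFinset φ A = comapFinset φ B} : Finset (ι → κ)).dens : ℝ) ≤
      Real.exp (-(ρ * Fintype.card ι)) := by
  have hfilter : ({φ | comapFinset φ A = comapFinset φ B} : Finset (ι → κ)) =
      Fintype.piFinset fun _ => (A ∆ B)ᶜ := by
    ext φ
    simp only [mem_filter, mem_univ, true_and, Finset.ext_iff, mem_comapFinset,
      Fintype.mem_piFinset, mem_compl, mem_symmDiff]
    exact forall_congr' fun i => by tauto
  have hcompl : (((A ∆ B)ᶜ).dens : ℝ) = 1 - (A ∆ B).dens := by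
    simp only [nnratCast_dens]
    rw [card_compl, Nat.cast_sub (card_le_univ _)]
    field_simp
  calc _ = (((A ∆ B)ᶜ).dens : ℝ) ^ Fintype.card ι := by
        simp [hfilter, nnratCast_dens, Fintype.card_piFinset, div_pow]
    _ ≤ Real.exp (-ρ) ^ Fintype.card ι := by
        gcongr
        linarith [Real.add_one_le_exp (-ρ)]
    _ = _ := by rw [← Real.exp_nat_mul]; ring_nf

theorem exists_injOn_comapFinset_of_separated {ι : Type*} [Fintype ι] [Nonempty κ]
    {𝒩 : Finset (Finset κ)} (h𝒩 : 𝒩.Nonempty) {ρ : ℝ}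
    (hsep : (𝒩 : Set (Finset κ)).Pairwise fun A B => ρ ≤ (A ∆ B).dens)
    (hι : 2 * Real.log #𝒩 ≤ ρ * Fintype.card ι) :
    ∃ φ : ι → κ, Set.InjOn (comapFinset φ) 𝒩 := by
  classical
  by_contra! hcon
  let collide : Finset κ × Finset κ → Finset (ι → κ) := fun p =>
    {φ | comapFinset φ p.1 = comapFinset φ p.2}
  have hcover : (univ : Finset (ι → κ)) ⊆ 𝒩.offDiag.biUnion collide := fun φ _ => by
    obtain ⟨A, hA, B, hB, hAB, hne⟩ := by simpa only [Set.InjOn, not_forall] using hcon φ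
    exact mem_biUnion.2 ⟨(A, B), mem_offDiag.2 ⟨hA, hB, hne⟩, by simpa [collide] using hAB⟩
  have hN : (0 : ℝ) < #𝒩 := by exact_mod_cast h𝒩.card_pos
  have hexp : Real.exp (-(ρ * Fintype.card ι)) ≤ ((#𝒩 : ℝ) ^ 2)⁻¹ := by
    rw [← Real.exp_log (by positivity : (0 : ℝ) < ((#𝒩 : ℝ) ^ 2)⁻¹), Real.log_inv, Real.log_pow]
    exact Real.exp_le_exp.2 (by push_cast; linarith)
  have hoff : (#𝒩.offDiag : ℝ) = (#𝒩 : ℝ) ^ 2 - #𝒩 := by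
    rw [offDiag_card, Nat.cast_sub (Nat.le_mul_self _)]
    push_cast
    ring
  have hlt : (1 : ℝ) < 1 := calc
    (1 : ℝ) = (univ : Finset (ι → κ)).dens := by simp
    _ ≤ ∑ p ∈ 𝒩.offDiag, ((collide p).dens : ℝ) := by
        simp only [nnratCast_dens, ← sum_div]
        gcongr
        exact_mod_cast (card_le_card hcover).trans card_biUnion_le
    _ ≤ ∑ p ∈ 𝒩.offDiag, ((#𝒩 : ℝ) ^ 2)⁻¹ := by
        refine sum_le_sum fun p hp => ?_
        obtain ⟨hA, hB, hne⟩ := mem_offDiag.1 hp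
        exact (dens_comapFinset_eq_le (hsep hA hB hne)).trans hexp
    _ < 1 := by
        rw [sum_const, nsmul_eq_mul, ← div_eq_mul_inv, div_lt_one (by positivity)]
        linarith
  exact hlt.false

/-- The exponent `6 / 5` and the constant `13` come from splitting off the factor `exp (y / 6)`,
which absorbs the linear factor since `e y ≤ 6 exp (y / 6)`. -/
theorem le_log_of_exp_le_mul {y ρ : ℝ} (hρ : 0 < ρ) (hρ1 : ρ ≤ 1 / 10) (hy : 0 ≤ y)
    (h : Real.exp y ≤ Real.exp 1 * (2 * y / ρ + 2)) : y ≤ 6 / 5 * Real.log (13 / ρ) := by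
  set z := Real.exp (y / 6) with hz
  have hz1 : 1 ≤ z := Real.one_le_exp (by positivity)
  have hlin : Real.exp 1 * y ≤ 6 * z := by
    have htangent := Real.add_one_le_exp (y / 6 - 1)
    rw [Real.exp_sub, ← hz, sub_add_cancel, le_div_iff₀ (Real.exp_pos 1)] at htangent
    linarith
  have hsplit : z * Real.exp (5 / 6 * y) ≤ z * (13 / ρ) := calc
    z * Real.exp (5 / 6 * y) = Real.exp y := by rw [hz, ← Real.exp_add]; ring_nf
    _ ≤ (2 * (Real.exp 1 * y) + 2 * Real.exp 1 * ρ) / ρ := h.trans_eq (by field_simp)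
    _ ≤ z * 13 / ρ := by
        gcongr
        nlinarith [Real.exp_one_lt_d9]
    _ = z * (13 / ρ) := by ring
  have hexp : Real.exp (5 / 6 * y) ≤ 13 / ρ := le_of_mul_le_mul_left hsplit (by linarith)
  rw [← Real.le_log_iff_exp_le (by positivity)] at hexp
  linarith

theorem exp_log_div_le_of_le_pow {N x : ℝ} {D : ℕ} (hD : 1 ≤ D) (hN : 0 < N) (hx : 0 ≤ x)
    (h : N ≤ x ^ D) : Real.exp (Real.log N / D) ≤ x := by
  have : (D : ℝ) ≠ 0 := by exact_mod_cast (by omega : D ≠ 0)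
  refine le_of_pow_le_pow_left₀ (n := D) (by omega) hx ?_
  rwa [← Real.exp_nat_mul, mul_div_cancel₀ _ this, Real.exp_log hN]

theorem log_card_le_of_separated [Nonempty κ] {𝒩 : Finset (Finset κ)} {ρ : ℝ} (hρ : 0 < ρ)
    (hρ1 : ρ ≤ 1 / 10) (hsep : (𝒩 : Set (Finset κ)).Pairwise fun A B => ρ ≤ (A ∆ B).dens)
    {D : ℕ} (hD : 1 ≤ D) (hvc : 𝒩.vcDim ≤ D) :
    Real.log #𝒩 ≤ 6 / 5 * D * Real.log (13 / ρ) := by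
  have hD1 : (1 : ℝ) ≤ D := by exact_mod_cast hD
  rcases 𝒩.eq_empty_or_nonempty with rfl | h𝒩
  · have : 0 ≤ Real.log (13 / ρ) := Real.log_nonneg (by rw [le_div_iff₀ hρ]; linarith)
    simp only [card_empty, Nat.cast_zero, Real.log_zero]
    positivity
  have hN1 : (1 : ℝ) ≤ #𝒩 := by exact_mod_cast h𝒩.card_pos
  have : 0 ≤ Real.log #𝒩 := Real.log_nonneg hN1
  set y := Real.log #𝒩 / D with hy
  have hyD : Real.log #𝒩 = D * y := by rw [hy]; field_simp
  set k := ⌈2 * Real.log #𝒩 / ρ⌉₊ + D with hk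
  have hk_lower : 2 * Real.log #𝒩 ≤ ρ * Fintype.card (Fin k) := by
    have hceil := Nat.le_ceil (2 * Real.log #𝒩 / ρ)
    rw [div_le_iff₀ hρ] at hceil
    rw [Fintype.card_fin, hk]
    push_cast
    nlinarith
  have hk_upper : (k : ℝ) ≤ D * (2 * y / ρ + 2) := by
    have hceil := (Nat.ceil_lt_add_one (a := 2 * Real.log #𝒩 / ρ) (by positivity)).le
    have hdiv : 2 * Real.log #𝒩 / ρ = D * (2 * y / ρ) := by rw [hyD]; ring
    rw [hk]
    push_cast
    linarith
  obtain ⟨φ, hφ⟩ := exists_injOn_comapFinset_of_separated h𝒩 hsep hk_lower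
  have hcard : (#𝒩 : ℝ) ≤ (Real.exp 1 * k / D) ^ D := by
    have hsauer := card_le_exp_mul_div_pow_of_vcDim_le ((vcDim_comapFamily_le φ 𝒩).trans hvc) hD
      (by simp [hk])
    rwa [comapFamily, card_image_of_injOn hφ, Fintype.card_fin] at hsauer
  have hexp : Real.exp y ≤ Real.exp 1 * (2 * y / ρ + 2) := by
    refine (exp_log_div_le_of_le_pow hD (by linarith) (by positivity) hcard).trans ?_
    rw [div_le_iff₀ (by positivity), mul_assoc, mul_comm _ (D : ℝ)]
    gcongr
  rw [hyD, mul_comm (6 / 5) (D : ℝ), mul_assoc]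
  gcongr
  exact le_log_of_exp_le_mul hρ hρ1 (by positivity) hexp

theorem exists_separated_net {α : Type*} [DecidableEq α] (𝒯 : Finset (Finset α)) {r : ℝ}
    (hr : 0 ≤ r) : ∃ 𝒩 ⊆ 𝒯, ((𝒩 : Set (Finset α)).Pairwise fun A B => r < #(A ∆ B)) ∧
      ∀ A ∈ 𝒯, ∃ B ∈ 𝒩, (#(A ∆ B) : ℝ) ≤ r := by
  classical
  let Separated : Finset (Finset α) → Prop := fun 𝒩 =>
    (𝒩 : Set (Finset α)).Pairwise fun A B => r < #(A ∆ B)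
  obtain ⟨𝒩, h𝒩, hmax⟩ := exists_max_image (𝒯.powerset.filter Separated) card
    ⟨∅, by simp [Separated]⟩
  obtain ⟨hsub, hsep⟩ := mem_filter.1 h𝒩
  rw [mem_powerset] at hsub
  refine ⟨𝒩, hsub, hsep, fun A hA => ?_⟩
  by_contra! hfar
  have hA𝒩 : A ∉ 𝒩 := fun h => hr.not_gt (by simpa using hfar A h)
  have hins : Separated (insert A 𝒩) := by
    simp only [Separated, coe_insert]
    have : Std.Symm fun A B : Finset α => r < #(A ∆ B) := ⟨fun A B h => by rwa [symmDiff_comm]⟩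
    exact hsep.insert_of_symm fun B hB _ => hfar B hB
  have hcard := hmax _ (mem_filter.2 ⟨mem_powerset.2 (insert_subset hA hsub), hins⟩)
  rw [card_insert_of_notMem hA𝒩] at hcard
  omega

end Packing

section Rademacher

variable {ι : Type*} [Fintype ι]

theorem card_eq_sum_indicator (A : Finset (ι × Bool)) :
    (#A : ℝ) =
      ∑ j, (Set.indicator A (1 : ι × Bool → ℝ) (j, true) + Set.indicator A 1 (j, false)) := by
  have hcard : (#A : ℝ) = ∑ p : ι × Bool, Set.indicator A 1 p := by
    classical simp [Set.indicator_apply]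
  rw [hcard, Fintype.sum_prod_type]
  exact sum_congr rfl fun j _ => Fintype.sum_bool _

variable [DecidableEq ι]

/-- The Rademacher sign attached to a fair bit. -/
def boolSign (b : Bool) : ℝ := if b then 1 else -1

theorem expect_exp_rademacher_le (t : ℝ) (c : ι → ℝ) :
    𝔼 s : ι → Bool, Real.exp (t * ∑ j, boolSign (s j) * c j) ≤
      Real.exp (t ^ 2 / 2 * ∑ j, c j ^ 2) := by
  have hfactor : ∀ s : ι → Bool, Real.exp (t * ∑ j, boolSign (s j) * c j) =
      ∏ j, Real.exp (t * (boolSign (s j) * c j)) := fun s => by rw [mul_sum, Real.exp_sum]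
  have hcosh : ∀ j, ∑ b, Real.exp (t * (boolSign b * c j)) = 2 * Real.cosh (t * c j) := fun j => by
    rw [Fintype.sum_bool, Real.cosh_eq]
    simp only [boolSign, if_true, Bool.false_eq_true, if_false, one_mul, neg_mul, mul_neg]
    ring
  calc 𝔼 s : ι → Bool, Real.exp (t * ∑ j, boolSign (s j) * c j)
      = (∏ j, 2 * Real.cosh (t * c j)) / 2 ^ Fintype.card ι := by
        simp_rw [Fintype.expect_eq_sum_div_card, hfactor, ← hcosh, Fintype.prod_sum]
        simp
    _ = ∏ j, Real.cosh (t * c j) := by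
        rw [prod_mul_distrib, prod_const, card_univ, mul_div_cancel_left₀ _ (by positivity)]
    _ ≤ ∏ j, Real.exp ((t * c j) ^ 2 / 2) :=
        prod_le_prod (fun j _ => (Real.cosh_pos _).le) fun j _ => Real.cosh_le_exp_half_sq _
    _ = Real.exp (t ^ 2 / 2 * ∑ j, c j ^ 2) := by
        rw [← Real.exp_sum, mul_sum]
        ring_nf

/-- For a set `A` of elements of pairs indexed by `ι`: the number of pairs whose element chosen by
`s` lies in `A` minus the number of pairs whose rejected element does. -/
def signedCount (s : ι → Bool) (A : Finset (ι × Bool)) : ℝ :=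
  #(comapFinset (fun j => (j, s j)) A) - #(comapFinset (fun j => (j, !s j)) A)

theorem signedCount_eq_sum_indicator (s : ι → Bool) (A : Finset (ι × Bool)) :
    signedCount s A = ∑ j, boolSign (s j) *
      (Set.indicator A (1 : ι × Bool → ℝ) (j, true) - Set.indicator A 1 (j, false)) := by
  simp only [signedCount, comapFinset, card_filter, Nat.cast_sum, ← sum_sub_distrib]
  refine sum_congr rfl fun j _ => ?_
  cases s j <;> simp [boolSign, Set.indicator_apply]

theorem expect_exp_signedCount_le (t : ℝ) (A : Finset (ι × Bool)) :
    𝔼 s, Real.exp (t * signedCount s A) ≤ Real.exp (t ^ 2 / 2 * #A) := by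
  simp_rw [signedCount_eq_sum_indicator]
  refine (expect_exp_rademacher_le t _).trans ?_
  rw [card_eq_sum_indicator A]
  gcongr with j
  simp only [Set.indicator_apply, Pi.one_apply]
  split_ifs <;> norm_num

theorem expect_exp_signedCount_sub_le (t : ℝ) (A B : Finset (ι × Bool)) :
    𝔼 s, Real.exp (t * (signedCount s A - signedCount s B)) ≤ Real.exp (t ^ 2 * #(A ∆ B)) := by
  let diff : ι × Bool → ℝ := fun p => Set.indicator A 1 p - Set.indicator B 1 p
  have hdiff : ∀ s, signedCount s A - signedCount s B =
      ∑ j, boolSign (s j) * (diff (j, true) - diff (j, false)) := fun s => by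
    rw [signedCount_eq_sum_indicator, signedCount_eq_sum_indicator, ← sum_sub_distrib]
    exact sum_congr rfl fun j _ => by ring
  have hsq : ∀ p, diff p ^ 2 = Set.indicator (A ∆ B : Finset (ι × Bool)) 1 p := fun p => by
    simp only [diff, Set.indicator_apply, mem_coe, mem_symmDiff, Pi.one_apply]
    by_cases hA : p ∈ A <;> by_cases hB : p ∈ B <;> simp [hA, hB]
  have hsum : ∑ j, (diff (j, true) - diff (j, false)) ^ 2 ≤ 2 * #(A ∆ B) := by
    rw [card_eq_sum_indicator, mul_sum]
    refine sum_le_sum fun j _ => ?_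
    rw [← hsq, ← hsq]
    linarith [sq_nonneg (diff (j, true) + diff (j, false))]
  simp_rw [hdiff]
  refine (expect_exp_rademacher_le t _).trans (Real.exp_le_exp.2 ?_)
  nlinarith [sq_nonneg t]

/-- The signed count scaled by `a`, penalised in proportion to the size of `A`: relative deviations
between two halves of a double sample are events that a tilted count is large. -/
noncomputable def tiltedCount (a ε : ℝ) (s : ι → Bool) (A : Finset (ι × Bool)) : ℝ :=
  a * signedCount s A - ε / 2 * #A

/-- The rate `ε / a₀ ^ 2` is the one at which the penalty exactly absorbs the variance of the signed
count. -/
theorem expect_exp_tiltedCount_le {a a₀ : ℝ} (ha₀ : 0 < a₀) (ha : |a| ≤ a₀) (ε : ℝ)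
    (A : Finset (ι × Bool)) : 𝔼 s, Real.exp (ε / a₀ ^ 2 * tiltedCount a ε s A) ≤ 1 := by
  set u := ε / a₀ ^ 2 with hu
  have huε : u * ε = u ^ 2 * a₀ ^ 2 := by rw [hu]; field_simp
  calc 𝔼 s, Real.exp (u * tiltedCount a ε s A)
      = 𝔼 s, Real.exp (-(u * ε / 2 * #A)) * Real.exp (u * a * signedCount s A) := by
        refine expect_congr rfl fun s _ => ?_
        rw [← Real.exp_add, tiltedCount]
        ring_nf
    _ ≤ Real.exp (-(u * ε / 2 * #A)) * Real.exp ((u * a) ^ 2 / 2 * #A) := by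
        rw [← mul_expect]
        gcongr
        exact expect_exp_signedCount_le _ _
    _ ≤ 1 := by
        rw [← Real.exp_add, Real.exp_le_one_iff, huε, mul_pow, neg_add_nonpos_iff]
        have := sq_le_sq' (neg_le_of_abs_le ha) (le_of_abs_le ha)
        gcongr

theorem expect_exp_tiltedCount_sub_le {ε v : ℝ} (hε : 0 ≤ ε) (hv : 0 ≤ v) (a : ℝ)
    (A B : Finset (ι × Bool)) :
    𝔼 s, Real.exp (v * (tiltedCount a ε s A - tiltedCount a ε s B)) ≤
      Real.exp ((v ^ 2 * a ^ 2 + v * ε / 2) * #(A ∆ B)) := by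
  have hcard : (#B : ℝ) ≤ #A + #(A ∆ B) := by
    have hsub : B ⊆ A ∪ A ∆ B := fun p hp => by
      by_cases hA : p ∈ A <;> simp [mem_symmDiff, hA, hp]
    exact_mod_cast (card_le_card hsub).trans (card_union_le _ _)
  calc 𝔼 s, Real.exp (v * (tiltedCount a ε s A - tiltedCount a ε s B))
      = 𝔼 s, Real.exp (v * ε / 2 * (#B - #A)) *
          Real.exp (v * a * (signedCount s A - signedCount s B)) := by
        refine expect_congr rfl fun s _ => ?_
        rw [← Real.exp_add, tiltedCount, tiltedCount]
        ring_nf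
    _ ≤ Real.exp (v * ε / 2 * (#B - #A)) * Real.exp ((v * a) ^ 2 * #(A ∆ B)) := by
        rw [← mul_expect]
        gcongr
        exact expect_exp_signedCount_sub_le _ _ _
    _ ≤ _ := by
        rw [← Real.exp_add, add_comm, mul_pow, add_mul]
        gcongr
        linarith

end Rademacher

section Chaining

theorem exp_inv_sum_inv_mul_sum_le {ι : Type*} {t : Finset ι} (ht : t.Nonempty) {θ : ι → ℝ}
    (hθ : ∀ i ∈ t, 0 < θ i) (Y : ι → ℝ) :
    Real.exp ((∑ i ∈ t, (θ i)⁻¹)⁻¹ * ∑ i ∈ t, Y i) ≤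
      (∑ i ∈ t, (θ i)⁻¹)⁻¹ * ∑ i ∈ t, (θ i)⁻¹ * Real.exp (θ i * Y i) := by
  have hW : 0 < ∑ i ∈ t, (θ i)⁻¹ := sum_pos (fun i hi => inv_pos.2 (hθ i hi)) ht
  have hjensen := convexOn_exp.map_sum_le (t := t) (w := fun i => (∑ i ∈ t, (θ i)⁻¹)⁻¹ * (θ i)⁻¹)
    (p := fun i => θ i * Y i) (fun i hi => by have := hθ i hi; positivity)
    (by rw [← mul_sum, inv_mul_cancel₀ hW.ne']) fun i _ => Set.mem_univ _
  simp only [smul_eq_mul, mul_assoc, ← mul_sum] at hjensen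
  rwa [sum_congr rfl fun i hi => inv_mul_cancel_left₀ (hθ i hi).ne' (Y i)] at hjensen

variable {α : Type*}

/-- The contribution of level `k` to the telescoping sum of `f` along a chain with projections `π`:
the value at the base point for `k = 0`, and the increment over the preceding point otherwise. -/
def chainLink (f : α → ℝ) (π : ℕ → α → α) : ℕ → α → ℝ
  | 0, B => f B
  | k + 1, B => f B - f (π k B)

theorem exists_chain_sum_chainLink {𝒩 : ℕ → Finset α} {π : ℕ → α → α}
    (hπ : ∀ k, ∀ B ∈ 𝒩 (k + 1), π k B ∈ 𝒩 k) (f : α → ℝ) (K : ℕ) {A : α} (hA : A ∈ 𝒩 K) :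
    ∃ c : ℕ → α, (∀ k ≤ K, c k ∈ 𝒩 k) ∧ f A = ∑ k ∈ range (K + 1), chainLink f π k (c k) := by
  induction K generalizing A with
  | zero => exact ⟨fun _ => A, fun k hk => by rwa [Nat.le_zero.1 hk], by simp [chainLink]⟩
  | succ K ih =>
    obtain ⟨c, hc, hsum⟩ := ih (hπ K A hA)
    refine ⟨Function.update c (K + 1) A, fun k hk => ?_, ?_⟩
    · rcases hk.lt_or_eq with hlt | rfl
      · rw [Function.update_of_ne hlt.ne]
        exact hc k (Nat.lt_succ_iff.1 hlt)
      · rwa [Function.update_self]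
    · have hinit : ∀ k ∈ range (K + 1),
          chainLink f π k (Function.update c (K + 1) A k) = chainLink f π k (c k) := fun k hk => by
        rw [Function.update_of_ne (mem_range.1 hk).ne]
      rw [sum_range_succ, sum_congr rfl hinit, ← hsum, Function.update_self, chainLink]
      ring

theorem expect_iSup_exp_le_of_chainLink {Ω : Type*} [Fintype Ω] {𝒩 : ℕ → Finset α}
    {π : ℕ → α → α} (hπ : ∀ k, ∀ B ∈ 𝒩 (k + 1), π k B ∈ 𝒩 k) {θ : ℕ → ℝ} (hθ : ∀ k, 0 < θ k)
    {K : ℕ} {X : Ω → α → ℝ} {ℓ : ℕ → ℝ} {η : ℝ}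
    (hlevel : ∀ k, 𝔼 ω, ∑ B ∈ 𝒩 k, Real.exp (θ k * (chainLink (X ω) π k B - ℓ k)) ≤ η) :
    𝔼 ω, ⨆ A : 𝒩 K, Real.exp ((∑ k ∈ range (K + 1), (θ k)⁻¹)⁻¹ *
      (X ω A - ∑ k ∈ range (K + 1), ℓ k)) ≤ η := by
  set W := ∑ k ∈ range (K + 1), (θ k)⁻¹ with hW
  have hW0 : 0 < W := sum_pos (fun k _ => inv_pos.2 (hθ k)) nonempty_range_add_one
  have hpoint : ∀ ω, ⨆ A : 𝒩 K, Real.exp (W⁻¹ * (X ω A - ∑ k ∈ range (K + 1), ℓ k)) ≤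
      W⁻¹ * ∑ k ∈ range (K + 1), (θ k)⁻¹ *
        ∑ B ∈ 𝒩 k, Real.exp (θ k * (chainLink (X ω) π k B - ℓ k)) := by
    intro ω
    refine Real.iSup_le (fun A => ?_) (mul_nonneg (inv_nonneg.2 hW0.le) (sum_nonneg fun k _ =>
      mul_nonneg (inv_nonneg.2 (hθ k).le) (sum_nonneg fun B _ => (Real.exp_pos _).le)))
    obtain ⟨c, hc, hsum⟩ := exists_chain_sum_chainLink hπ (X ω) K A.2
    rw [hsum, ← sum_sub_distrib]
    refine (exp_inv_sum_inv_mul_sum_le nonempty_range_add_one (fun k _ => hθ k) _).trans ?_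
    gcongr with k hk
    · exact inv_nonneg.2 (hθ k).le
    · exact single_le_sum (f := fun B => Real.exp (θ k * (chainLink (X ω) π k B - ℓ k)))
        (fun B _ => (Real.exp_pos _).le) (hc k (Nat.lt_succ_iff.1 (mem_range.1 hk)))
  calc _ ≤ 𝔼 ω, W⁻¹ * ∑ k ∈ range (K + 1), (θ k)⁻¹ *
        ∑ B ∈ 𝒩 k, Real.exp (θ k * (chainLink (X ω) π k B - ℓ k)) :=
        expect_le_expect fun ω _ => hpoint ω
    _ = W⁻¹ * ∑ k ∈ range (K + 1), (θ k)⁻¹ *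
        𝔼 ω, ∑ B ∈ 𝒩 k, Real.exp (θ k * (chainLink (X ω) π k B - ℓ k)) := by
        rw [← mul_expect, expect_sum_comm]
        simp_rw [← mul_expect]
    _ ≤ W⁻¹ * ∑ k ∈ range (K + 1), (θ k)⁻¹ * η := by
        gcongr with k
        · exact inv_nonneg.2 (hθ k).le
        · exact hlevel k
    _ = η := by rw [← sum_mul, ← hW, inv_mul_cancel_left₀ hW0.ne']

theorem exists_chain_of_separated_nets [DecidableEq α] (𝒯 : Finset (Finset α)) {r : ℕ → ℝ}
    (hr : ∀ k, 0 ≤ r k) : ∃ (𝒩 : ℕ → Finset (Finset α)) (π : ℕ → Finset α → Finset α),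
      (∀ k, 𝒩 k ⊆ 𝒯) ∧
      (∀ k, (𝒩 k : Set (Finset α)).Pairwise fun A B => r k < #(A ∆ B)) ∧
      (∀ k, ∀ A ∈ 𝒯, π k A ∈ 𝒩 k ∧ (#(A ∆ π k A) : ℝ) ≤ r k) ∧
      ∀ k, r k < 1 → 𝒩 k = 𝒯 := by
  choose 𝒩 hsub hsep hnet using fun k => exists_separated_net 𝒯 (hr k)
  choose! π hπ using hnet
  refine ⟨𝒩, π, hsub, hsep, hπ, fun k hk => (hsub k).antisymm fun A hA => ?_⟩
  obtain ⟨hmem, hdist⟩ := hπ k A hA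
  have hcard : #(A ∆ π k A) = 0 := Nat.lt_one_iff.1 (by exact_mod_cast hdist.trans_lt hk)
  rwa [symmDiff_eq_bot.1 (card_eq_zero.1 hcard)]

end Chaining

section TiltedSup

/-- The separation radius of the `k`-th net in the chain for a double sample of `M` pairs. -/
noncomputable def chainRadius (M ν : ℝ) (k : ℕ) : ℝ := M * ν / (250 * 64 ^ k)

/-- The exponential rate used at level `k` of the chain, in terms of the rate `u` at the base. The
rates may grow by the factor `16` per level because the radii shrink by the factor `64`. -/
def chainRate (u : ℝ) : ℕ → ℝ
  | 0 => u
  | k + 1 => u * (20 * 16 ^ k)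

/-- The part of the total deviation `L` that is allotted to level `k` of the chain. -/
noncomputable def chainAllowance (L : ℝ) : ℕ → ℝ
  | 0 => 4 / 5 * L
  | k + 1 => 3 / 20 * L * (1 / 4) ^ k

theorem chainRate_pos {u : ℝ} (hu : 0 < u) (k : ℕ) : 0 < chainRate u k := by
  cases k <;> simp only [chainRate] <;> positivity

theorem sum_chainAllowance_le {L : ℝ} (hL : 0 ≤ L) (K : ℕ) :
    ∑ k ∈ range (K + 1), chainAllowance L k ≤ L := by
  have hgeom : ∑ k ∈ range K, (1 / 4 : ℝ) ^ k ≤ 4 / 3 := by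
    have hpos : (0 : ℝ) ≤ (1 / 4) ^ K := by positivity
    rw [geom_sum_eq (by norm_num), div_le_iff_of_neg (by norm_num)]
    linarith
  rw [sum_range_succ']
  simp only [chainAllowance, ← mul_sum]
  nlinarith

theorem exists_chainRadius_lt_one (M ν : ℝ) : ∃ K, chainRadius M ν K < 1 := by
  obtain ⟨K, hK⟩ := pow_unbounded_of_one_lt (M * ν) (by norm_num : (1 : ℝ) < 64)
  have : (0 : ℝ) < 64 ^ K := by positivity
  exact ⟨K, by rw [chainRadius, div_lt_one (by positivity)]; linarith⟩

theorem chainRate_exponent_le {ε M ν a₀ : ℝ} (hM : 0 ≤ M) (hν : 0 ≤ ν) (ha₀ : 0 < a₀) (k : ℕ) :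
    (chainRate (ε / a₀ ^ 2) (k + 1) ^ 2 * a₀ ^ 2 + chainRate (ε / a₀ ^ 2) (k + 1) * ε / 2) *
        chainRadius M ν k -
      chainRate (ε / a₀ ^ 2) (k + 1) * chainAllowance (ε * M * ν) (k + 1) ≤
    -((4 / 5 + (k + 1 : ℕ) / 2) * (ε ^ 2 * M * ν / a₀ ^ 2)) := by
  have hbernoulli : (1 : ℝ) + 3 * k ≤ 4 ^ k := by
    have := one_add_mul_le_pow (by norm_num : (-2 : ℝ) ≤ 3) k
    norm_num at this
    linarith
  have h16 : (16 : ℝ) ^ k = (4 ^ k) ^ 2 := by rw [← pow_mul, mul_comm k, pow_mul]; norm_num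
  have h64 : (64 : ℝ) ^ k = (4 ^ k) ^ 3 := by rw [← pow_mul, mul_comm k, pow_mul]; norm_num
  have : (0 : ℝ) ≤ k := k.cast_nonneg
  simp only [chainRate, chainRadius, chainAllowance]
  rw [h16, h64, div_pow, one_pow, Nat.cast_succ]
  generalize (4 : ℝ) ^ k = x at *
  have hx : 0 < x := by linarith
  have hinv : 1 / x ≤ x := by rw [div_le_iff₀ hx]; nlinarith
  calc _ = (8 / 5 * x + 1 / 25 * (1 / x) - 3 * x) * (ε ^ 2 * M * ν / a₀ ^ 2) := by
        field_simp
        ring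
    _ ≤ -(4 / 5 + (k + 1 : ℝ) / 2) * (ε ^ 2 * M * ν / a₀ ^ 2) := by
        gcongr
        linarith
    _ = _ := by ring

theorem card_le_of_separated_chainRadius {ι : Type*} [Fintype ι] [DecidableEq ι] [Nonempty ι]
    {D : ℕ} (hD : 1 ≤ D) {ν : ℝ} (hν : 0 < ν) (hν4 : ν ≤ 4) (k : ℕ)
    {𝒩 : Finset (Finset (ι × Bool))} (hvc : 𝒩.vcDim ≤ D)
    (hsep : (𝒩 : Set (Finset (ι × Bool))).Pairwise
      fun A B => chainRadius (Fintype.card ι) ν k < #(A ∆ B)) :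
    (#𝒩 : ℝ) ≤ Real.exp (6 / 5 * D * Real.log (6500 / ν) + 5 * k * D) := by
  rcases 𝒩.eq_empty_or_nonempty with rfl | h𝒩
  · simp only [card_empty, Nat.cast_zero]
    positivity
  have h64 : (1 : ℝ) ≤ 64 ^ k := one_le_pow₀ (by norm_num)
  have hlog64 : Real.log 64 ≤ 25 / 6 := by
    rw [show (64 : ℝ) = 2 ^ 6 by norm_num, Real.log_pow]
    push_cast
    linarith [Real.log_two_lt_d9]
  have hpack := log_card_le_of_separated (𝒩 := 𝒩) (ρ := ν / (500 * 64 ^ k)) (by positivity)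
    (by rw [div_le_div_iff₀ (by positivity) (by norm_num)]; linarith)
    (fun A hA B hB hne => by
      simp only [nnratCast_dens]
      rw [le_div_iff₀ (by positivity)]
      refine le_trans (le_of_eq ?_) (hsep hA hB hne).le
      simp only [chainRadius, Fintype.card_prod, Fintype.card_bool, Nat.cast_mul]
      field_simp
      norm_num) hD hvc
  have hlog : Real.log (13 / (ν / (500 * 64 ^ k))) = Real.log (6500 / ν) + k * Real.log 64 := by
    rw [← Real.log_pow, ← Real.log_mul (by positivity) (by positivity)]
    congr 1
    field_simp
    norm_num
  rw [← Real.log_le_iff_le_exp (by exact_mod_cast h𝒩.card_pos)]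
  calc Real.log #𝒩 ≤ 6 / 5 * D * Real.log (6500 / ν) + 6 / 5 * (k * D) * Real.log 64 :=
        hpack.trans_eq (by rw [hlog]; ring)
    _ ≤ 6 / 5 * D * Real.log (6500 / ν) + 6 / 5 * (k * D) * (25 / 6) := by gcongr
    _ = _ := by ring

/-- Every set family of VC dimension at most `D` on the pairs indexed by `ι` satisfies a uniform
exponential deviation bound for tilted counts with tilts in `[-a₀, a₀]`: some rate `Λ`, common to
all these families, makes the expected supremum at the deviation `ε |ι| ν` at most `η`. -/
def TiltedSupBound (ι : Type*) [Fintype ι] [DecidableEq ι] (D : ℕ) (ε a₀ ν η : ℝ) : Prop :=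
  ∃ Λ : ℝ, 0 < Λ ∧ ∀ 𝒯 : Finset (Finset (ι × Bool)), 𝒯.vcDim ≤ D → ∀ a : ℝ, |a| ≤ a₀ →
    𝔼 s : ι → Bool, ⨆ A : 𝒯, Real.exp (Λ * (tiltedCount a ε s A - ε * Fintype.card ι * ν)) ≤ η

variable {ι : Type*} [Fintype ι] [DecidableEq ι]

theorem expect_exp_chainLink_tiltedCount_le {a a₀ ε ν : ℝ} (hε : 0 < ε) (hν : 0 ≤ ν)
    (ha₀ : 0 < a₀) (ha : |a| ≤ a₀) {π : ℕ → Finset (ι × Bool) → Finset (ι × Bool)} (k : ℕ)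
    {B : Finset (ι × Bool)}
    (hB : ∀ j, (#(B ∆ π j B) : ℝ) ≤ chainRadius (Fintype.card ι) ν j) :
    𝔼 s, Real.exp (chainRate (ε / a₀ ^ 2) k * (chainLink (tiltedCount a ε s) π k B -
        chainAllowance (ε * Fintype.card ι * ν) k)) ≤
      Real.exp (-((4 / 5 + k / 2) * (ε ^ 2 * Fintype.card ι * ν / a₀ ^ 2))) := by
  simp_rw [mul_sub, Real.exp_sub, ← expect_div]
  rw [div_le_iff₀ (Real.exp_pos _), ← Real.exp_add]
  cases k with
  | zero =>
    refine (expect_exp_tiltedCount_le ha₀ ha ε B).trans_eq ?_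
    rw [eq_comm, Real.exp_eq_one_iff]
    simp only [chainRate, chainAllowance, Nat.cast_zero]
    ring
  | succ k =>
    have hv := (chainRate_pos (by positivity : 0 < ε / a₀ ^ 2) (k + 1)).le
    refine (expect_exp_tiltedCount_sub_le hε.le hv a B (π k B)).trans (Real.exp_le_exp.2 ?_)
    have hexponent := chainRate_exponent_le (ε := ε) (Nat.cast_nonneg (Fintype.card ι)) hν ha₀ k
    have hsq : a ^ 2 ≤ a₀ ^ 2 := sq_le_sq' (neg_le_of_abs_le ha) (le_of_abs_le ha)
    calc _ ≤ (chainRate (ε / a₀ ^ 2) (k + 1) ^ 2 * a₀ ^ 2 +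
          chainRate (ε / a₀ ^ 2) (k + 1) * ε / 2) * chainRadius (Fintype.card ι) ν k := by
          gcongr
          exact hB k
      _ ≤ _ := by linarith

theorem ten_mul_le_of_log_le {D Q ν η : ℝ} (hD : 0 ≤ D) (hν : 0 < ν) (hν4 : ν ≤ 4) (hη : 0 < η)
    (hη1 : η ≤ 1) (hQ : 6 / 5 * D * Real.log (6500 / ν) + Real.log (1 / η) ≤ 4 / 5 * Q) :
    10 * D ≤ Q := by
  have hlogη : 0 ≤ Real.log (1 / η) := Real.log_nonneg (by rwa [one_le_div hη])
  have hlog : 20 / 3 ≤ Real.log (6500 / ν) := by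
    have hmono : Real.log (2 ^ 10) ≤ Real.log (6500 / ν) := by
      refine Real.log_le_log (by norm_num) ?_
      rw [le_div_iff₀ hν]
      linarith
    rw [Real.log_pow] at hmono
    push_cast at hmono
    linarith [Real.log_two_gt_d9]
  nlinarith

theorem tiltedSupBound_of_chaining [Nonempty ι] {D : ℕ} {ε a₀ ν η : ℝ} (hε : 0 < ε) (hD : 1 ≤ D)
    (ha₀ : 0 < a₀) (hν : 0 < ν) (hν4 : ν ≤ 4) (hη : 0 < η) (hη1 : η ≤ 1)
    (hQ : 6 / 5 * D * Real.log (6500 / ν) + Real.log (1 / η) ≤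
      4 / 5 * (ε ^ 2 * Fintype.card ι * ν / a₀ ^ 2)) :
    TiltedSupBound ι D ε a₀ ν η := by
  set Q := ε ^ 2 * Fintype.card ι * ν / a₀ ^ 2
  set θ := chainRate (ε / a₀ ^ 2)
  have hθ : ∀ k, 0 < θ k := chainRate_pos (by positivity)
  have hQD : 10 * (D : ℝ) ≤ Q := ten_mul_le_of_log_le D.cast_nonneg hν hν4 hη hη1 hQ
  obtain ⟨K, hK⟩ := exists_chainRadius_lt_one (Fintype.card ι) ν
  have hW : 0 < ∑ k ∈ range (K + 1), (θ k)⁻¹ :=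
    sum_pos (fun k _ => inv_pos.2 (hθ k)) nonempty_range_add_one
  refine ⟨(∑ k ∈ range (K + 1), (θ k)⁻¹)⁻¹, inv_pos.2 hW, fun 𝒯 h𝒯 a ha => ?_⟩
  obtain ⟨𝒩, π, hsub, hsep, hπ, hfine⟩ := exists_chain_of_separated_nets 𝒯
    (r := chainRadius (Fintype.card ι) ν) fun k => by unfold chainRadius; positivity
  have hlevel : ∀ k, 𝔼 s, ∑ B ∈ 𝒩 k, Real.exp (θ k * (chainLink (tiltedCount a ε s) π k B -
      chainAllowance (ε * Fintype.card ι * ν) k)) ≤ η := fun k => calc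
    _ ≤ ∑ B ∈ 𝒩 k, Real.exp (-((4 / 5 + k / 2) * Q)) := by
        rw [expect_sum_comm]
        exact sum_le_sum fun B hB => expect_exp_chainLink_tiltedCount_le hε hν.le ha₀ ha k
          fun j => (hπ j B (hsub k hB)).2
    _ ≤ Real.exp (6 / 5 * D * Real.log (6500 / ν) + 5 * k * D) *
          Real.exp (-((4 / 5 + k / 2) * Q)) := by
        rw [sum_const, nsmul_eq_mul]
        gcongr
        exact card_le_of_separated_chainRadius hD hν hν4 k ((vcDim_mono (hsub k)).trans h𝒯) (hsep k)
    _ ≤ Real.exp (-Real.log (1 / η)) := by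
        rw [← Real.exp_add, Real.exp_le_exp]
        linarith [mul_le_mul_of_nonneg_left hQD (Nat.cast_nonneg' k : (0 : ℝ) ≤ k)]
    _ = η := by rw [one_div, Real.log_inv, neg_neg, Real.exp_log hη]
  rw [← hfine K hK]
  refine le_trans (expect_le_expect fun s _ => ciSup_mono (Finite.bddAbove_range _) fun A => ?_)
    (expect_iSup_exp_le_of_chainLink (fun k B hB => (hπ k B (hsub _ hB)).1) hθ hlevel)
  gcongr
  exact sum_chainAllowance_le (by positivity) K

theorem tiltedSupBound_of_card {D : ℕ} {ε a₀ ν η : ℝ} (hε : 0 < ε) (ha₀ : 0 < a₀) (hD : 1 ≤ D)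
    (hDι : D ≤ 2 * Fintype.card ι)
    (hη : (Real.exp 1 * (2 * Fintype.card ι) / D) ^ D *
      Real.exp (-(ε ^ 2 * Fintype.card ι * ν / a₀ ^ 2)) ≤ η) :
    TiltedSupBound ι D ε a₀ ν η := by
  refine ⟨ε / a₀ ^ 2, by positivity, fun 𝒯 h𝒯 a ha => le_trans ?_ hη⟩
  have hpairs : Fintype.card (ι × Bool) = 2 * Fintype.card ι := by simp [mul_comm]
  have hcard := card_le_exp_mul_div_pow_of_vcDim_le h𝒯 hD (hpairs ▸ hDι)
  rw [hpairs, Nat.cast_mul, Nat.cast_two] at hcard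
  calc _ ≤ 𝔼 s, ∑ A ∈ 𝒯,
          Real.exp (ε / a₀ ^ 2 * (tiltedCount a ε s A - ε * Fintype.card ι * ν)) := by
        refine expect_le_expect fun s _ => Real.iSup_le (fun A => ?_)
          (sum_nonneg fun A _ => (Real.exp_pos _).le)
        exact single_le_sum
          (f := fun A => Real.exp (ε / a₀ ^ 2 * (tiltedCount a ε s A - ε * Fintype.card ι * ν)))
          (fun B _ => (Real.exp_pos _).le) A.2
    _ ≤ ∑ A ∈ 𝒯, Real.exp (-(ε ^ 2 * Fintype.card ι * ν / a₀ ^ 2)) := by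
        rw [expect_sum_comm]
        refine sum_le_sum fun A _ => ?_
        simp_rw [mul_sub, Real.exp_sub, ← expect_div]
        rw [div_le_iff₀ (Real.exp_pos _), ← Real.exp_add]
        refine (expect_exp_tiltedCount_le ha₀ ha ε A).trans_eq ?_
        rw [eq_comm, Real.exp_eq_one_iff]
        ring
    _ ≤ _ := by
        rw [sum_const, nsmul_eq_mul]
        gcongr

end TiltedSup

section Expect

variable {α : Type*} [Fintype α]

theorem exp_expect_le_expect_exp [Nonempty α] (g : α → ℝ) :
    Real.exp (𝔼 x, g x) ≤ 𝔼 x, Real.exp (g x) := by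
  have hjensen := convexOn_exp.map_sum_le (t := univ) (w := fun _ => (Fintype.card α : ℝ)⁻¹)
    (p := g) (fun _ _ => by positivity) (by simp) fun _ _ => Set.mem_univ _
  simpa only [smul_eq_mul, ← mul_sum, Fintype.expect_eq_sum_div_card, div_eq_inv_mul] using hjensen

theorem dens_le_expect {B : Finset α} {g : α → ℝ} (hg : ∀ x, 0 ≤ g x)
    (hB : ∀ x ∈ B, 1 ≤ g x) : (B.dens : ℝ) ≤ 𝔼 x, g x := by
  rw [nnratCast_dens, Fintype.expect_eq_sum_div_card]
  gcongr
  calc (#B : ℝ) = ∑ x ∈ B, 1 := by simp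
    _ ≤ ∑ x ∈ B, g x := sum_le_sum hB
    _ ≤ ∑ x, g x := sum_le_sum_of_subset_of_nonneg (subset_univ B) fun x _ _ => hg x

theorem expect_eval {ι κ : Type*} [Fintype ι] [DecidableEq ι] [Fintype κ] [Nonempty κ]
    (j : ι) (g : κ → ℝ) : 𝔼 C : ι → κ, g (C j) = 𝔼 x, g x := by
  rw [Fintype.expect_equiv (Equiv.funSplitAt j κ) (fun C => g (C j)) (fun p => g p.1) fun _ => rfl,
    ← univ_product_univ, expect_product]
  simp

end Expect

section Symmetrization

variable {ι κ : Type*}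

/-- Splitting a double sample into the chosen and the rejected members of its pairs. -/
def splitEquiv (s : ι → Bool) : (ι × Bool → κ) ≃ (ι → κ) × (ι → κ) where
  toFun φ := (fun j => φ (j, s j), fun j => φ (j, !s j))
  invFun p := fun x => if x.2 = s x.1 then p.1 x.1 else p.2 x.1
  left_inv φ := by
    funext ⟨j, b⟩
    by_cases h : b = s j
    · simp [h]
    · simp [Bool.eq_not_of_ne h]
  right_inv p := by
    ext j <;> simp

variable [Fintype ι] [DecidableEq κ]

/-- The tilted count of a double sample in terms of its two halves, for a set `A` of points. -/
noncomputable def twoSampleTilt (a ε : ℝ) (C C' : ι → κ) (A : Finset κ) : ℝ :=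
  (a - ε / 2) * #(comapFinset C A) - (a + ε / 2) * #(comapFinset C' A)

theorem tiltedCount_comapFinset [DecidableEq ι] (a ε : ℝ) (s : ι → Bool) (φ : ι × Bool → κ)
    (A : Finset κ) : tiltedCount a ε s (comapFinset φ A) =
      twoSampleTilt a ε (splitEquiv s φ).1 (splitEquiv s φ).2 A := by
  have hcard : (#(comapFinset φ A) : ℝ) =
      #(comapFinset (splitEquiv s φ).1 A) + #(comapFinset (splitEquiv s φ).2 A) := by
    simp only [comapFinset, card_filter, Nat.cast_sum, Fintype.sum_prod_type, Fintype.sum_bool,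
      ← sum_add_distrib]
    refine sum_congr rfl fun j _ => ?_
    cases hs : s j <;> simp [splitEquiv, hs, add_comm]
  have hsigned : signedCount s (comapFinset φ A) =
      #(comapFinset (splitEquiv s φ).1 A) - #(comapFinset (splitEquiv s φ).2 A) := by
    simp only [signedCount, comapFinset, mem_filter_univ, splitEquiv, Equiv.coe_fn_mk]
    rfl
  rw [tiltedCount, hcard, hsigned, twoSampleTilt]
  ring

variable [Fintype κ] [DecidableEq ι] [Nonempty κ]

theorem expect_card_comapFinset (A : Finset κ) :
    𝔼 C : ι → κ, (#(comapFinset C A) : ℝ) = Fintype.card ι * A.dens := by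
  have hdens : 𝔼 x, (if x ∈ A then 1 else 0 : ℝ) = A.dens := by
    simp [Fintype.expect_eq_sum_div_card, nnratCast_dens]
  simp only [comapFinset, card_filter, Nat.cast_sum, Nat.cast_ite, Nat.cast_one, Nat.cast_zero]
  rw [expect_sum_comm]
  simp [expect_eval _ fun x => if x ∈ A then (1 : ℝ) else 0, hdens]

theorem one_le_expect_exp_twoSampleTilt {a ε ν Λ : ℝ} (hΛ : 0 ≤ Λ) {C : ι → κ} {A : Finset κ}
    (hdev : ε * (ν + A.dens) ≤ (a - ε / 2) * ((comapFinset C A).dens - A.dens)) :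
    1 ≤ 𝔼 C', Real.exp (Λ * (twoSampleTilt a ε C C' A - ε * Fintype.card ι * ν)) := by
  refine le_trans (Real.one_le_exp ?_) (exp_expect_le_expect_exp _)
  have hcard : (#(comapFinset C A) : ℝ) = Fintype.card ι * (comapFinset C A).dens := by
    exact_mod_cast (natCast_card_mul_nnratCast_dens (𝕜 := ℝ) (comapFinset C A)).symm
  simp only [twoSampleTilt]
  rw [← mul_expect, expect_sub_distrib, expect_sub_distrib, ← mul_expect (a := a + ε / 2),
    expect_card_comapFinset, hcard]
  simp only [Fintype.expect_const]
  refine mul_nonneg hΛ ?_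
  nlinarith [mul_le_mul_of_nonneg_left hdev (Nat.cast_nonneg' (Fintype.card ι) : (0 : ℝ) ≤ _)]

theorem expect_iSup_exp_twoSampleTilt_le {𝓕 : Finset (Finset κ)} {a ε ν η Λ : ℝ}
    (hsup : ∀ φ : ι × Bool → κ, 𝔼 s : ι → Bool, ⨆ A : comapFamily φ 𝓕,
      Real.exp (Λ * (tiltedCount a ε s A - ε * Fintype.card ι * ν)) ≤ η) :
    𝔼 C : ι → κ, 𝔼 C' : ι → κ, ⨆ A : 𝓕,
      Real.exp (Λ * (twoSampleTilt a ε C C' A - ε * Fintype.card ι * ν)) ≤ η := by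
  set F : (ι → κ) × (ι → κ) → ℝ := fun p =>
    ⨆ A : 𝓕, Real.exp (Λ * (twoSampleTilt a ε p.1 p.2 A - ε * Fintype.card ι * ν))
  have hF : ∀ (s : ι → Bool) (φ : ι × Bool → κ), F (splitEquiv s φ) ≤ ⨆ A : comapFamily φ 𝓕,
      Real.exp (Λ * (tiltedCount a ε s A - ε * Fintype.card ι * ν)) := fun s φ => by
    refine Real.iSup_le (fun A => ?_) (Real.iSup_nonneg fun A => (Real.exp_pos _).le)
    rw [← tiltedCount_comapFinset]
    exact le_ciSup (f := fun A : comapFamily φ 𝓕 =>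
      Real.exp (Λ * (tiltedCount a ε s A - ε * Fintype.card ι * ν))) (Finite.bddAbove_range _)
      ⟨_, mem_image_of_mem _ A.2⟩
  calc 𝔼 C, 𝔼 C', F (C, C')
      = 𝔼 s : ι → Bool, 𝔼 φ, F (splitEquiv s φ) := by
        rw [← expect_product', univ_product_univ]
        simp_rw [fun s => Fintype.expect_equiv (splitEquiv (κ := κ) s) (fun φ => F (splitEquiv s φ))
          F fun _ => rfl, Fintype.expect_const]
    _ = 𝔼 φ, 𝔼 s : ι → Bool, F (splitEquiv s φ) := expect_comm _ _ _
    _ ≤ 𝔼 _φ : ι × Bool → κ, η := expect_le_expect fun φ _ =>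
        (expect_le_expect fun s _ => hF s φ).trans (hsup φ)
    _ = η := Fintype.expect_const η

theorem TiltedSupBound.dens_deviating_le {D : ℕ} {a a₀ ε ν η : ℝ}
    (h : TiltedSupBound ι D ε a₀ ν η) (ha : |a| ≤ a₀) {𝓕 : Finset (Finset κ)} (h𝓕 : 𝓕.vcDim ≤ D)
    {B : Finset (ι → κ)} (hB : ∀ C ∈ B, ∃ A ∈ 𝓕,
      ε * (ν + A.dens) ≤ (a - ε / 2) * ((comapFinset C A).dens - A.dens)) :
    (B.dens : ℝ) ≤ η := by
  obtain ⟨Λ, hΛ, hsup⟩ := h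
  refine le_trans (dens_le_expect (fun C => expect_nonneg fun C' _ => Real.iSup_nonneg fun A =>
    (Real.exp_pos _).le) fun C hC => ?_) (expect_iSup_exp_twoSampleTilt_le fun φ =>
      hsup (comapFamily φ 𝓕) ((vcDim_comapFamily_le φ 𝓕).trans h𝓕) a ha)
  obtain ⟨A, hA, hdev⟩ := hB C hC
  refine (one_le_expect_exp_twoSampleTilt hΛ.le hdev).trans (expect_le_expect fun C' _ => ?_)
  exact le_ciSup (f := fun A : 𝓕 =>
    Real.exp (Λ * (twoSampleTilt a ε C C' A - ε * Fintype.card ι * ν))) (Finite.bddAbove_range _)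
    ⟨A, hA⟩

/-- The list `C` of points is a relative `(ν, ε)`-approximation for the family `𝓕`: its empirical
densities on the members of `𝓕` are off by at most `ε` relative to the true densities, up to the
resolution `ν`. -/
def IsRelativeApprox (𝓕 : Finset (Finset κ)) (ε ν : ℝ) (C : ι → κ) : Prop :=
  ∀ A ∈ 𝓕, |((comapFinset C A).dens : ℝ) - A.dens| ≤ ε * (ν + A.dens)

theorem TiltedSupBound.dens_not_isRelativeApprox_le {D : ℕ} {ε ν η : ℝ} (hε : 0 ≤ ε)
    (h : TiltedSupBound ι D ε (1 + ε / 2) ν η) {𝓕 : Finset (Finset κ)} (h𝓕 : 𝓕.vcDim ≤ D)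
    {B : Finset (ι → κ)} (hB : ∀ C ∈ B, ¬IsRelativeApprox 𝓕 ε ν C) :
    (B.dens : ℝ) ≤ 2 * η := by
  classical
  let above : Finset (ι → κ) :=
    {C | ∃ A ∈ 𝓕, ε * (ν + A.dens) ≤ ((comapFinset C A).dens : ℝ) - A.dens}
  let below : Finset (ι → κ) :=
    {C | ∃ A ∈ 𝓕, ε * (ν + A.dens) ≤ -(((comapFinset C A).dens : ℝ) - A.dens)}
  have hcover : B ⊆ above ∪ below := fun C hC => by
    obtain ⟨A, hA, hdev⟩ := by simpa only [IsRelativeApprox, not_forall, not_le] using hB C hC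
    simp only [above, below, mem_union, mem_filter, mem_univ, true_and]
    rcases lt_abs.1 hdev with hlt | hlt
    exacts [.inl ⟨A, hA, hlt.le⟩, .inr ⟨A, hA, hlt.le⟩]
  have habove : (above.dens : ℝ) ≤ η := by
    refine h.dens_deviating_le (a := 1 + ε / 2) (abs_of_nonneg (by positivity)).le h𝓕 fun C hC => ?_
    simpa [above] using hC
  have hbelow : (below.dens : ℝ) ≤ η := by
    refine h.dens_deviating_le (a := -1 + ε / 2) (abs_le.2 ⟨by linarith, by linarith⟩) h𝓕
      fun C hC => ?_
    simpa [below] using hC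
  have hunion : (B.dens : ℝ) ≤ above.dens + below.dens := by
    exact_mod_cast (dens_le_dens hcover).trans (dens_union_le above below)
  linarith

end Symmetrization

section SampleSize

/-- The resolution at which a sample whose size is governed by `S` is a relative approximation. The
constant `7 / 4` is small enough for `resolution S * (S - 2) ≤ 1` and large enough for
`resolution S * S * log S` to exceed an absolute constant for all `S ≥ 2`. -/
noncomputable def resolution (S : ℝ) : ℝ := 1 / (S - 7 / 4)

variable {S : ℝ}

theorem resolution_pos (hS : 2 ≤ S) : 0 < resolution S :=
  one_div_pos.2 (by linarith)

theorem resolution_le_four (hS : 2 ≤ S) : resolution S ≤ 4 := by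
  rw [resolution, div_le_iff₀ (by linarith)]
  linarith

theorem one_le_resolution_mul (hS : 2 ≤ S) : 1 ≤ resolution S * S := by
  rw [resolution, one_div_mul_eq_div, le_div_iff₀ (by linarith)]
  linarith

theorem resolution_mul_sub_two_le (hS : 2 ≤ S) : resolution S * (S - 2) ≤ 1 := by
  rw [resolution, one_div_mul_eq_div, div_le_iff₀ (by linarith)]
  linarith

theorem two_mul_log_two_add_one_le (hS : 2 ≤ S) :
    2 * Real.log 2 + 1 ≤ resolution S * S * Real.log S := by
  have hS0 : 0 < S := by linarith
  have hlog4 : Real.log 4 = 2 * Real.log 2 := by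
    rw [show (4 : ℝ) = 2 ^ 2 by norm_num, Real.log_pow, Nat.cast_two]
  -- The tangent to `log` at `4`.
  have htangent : 2 * Real.log 2 + 1 - 4 / S ≤ Real.log S := by
    have := Real.log_le_sub_one_of_pos (by positivity : 0 < 4 / S)
    rw [Real.log_div (by norm_num) hS0.ne', hlog4] at this
    linarith
  have hmul : S * (2 * Real.log 2 + 1) - 4 ≤ S * Real.log S := by
    refine le_trans (le_of_eq ?_) (mul_le_mul_of_nonneg_left htangent hS0.le)
    field_simp
  rw [resolution, one_div_mul_eq_div, div_mul_eq_mul_div, le_div_iff₀ (by linarith)]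
  linarith [Real.log_two_gt_d9]

theorem log_div_resolution_le (hS : 2 ≤ S) {c : ℝ} {j : ℕ} (hc : 0 < c) (hcj : c ≤ 2 ^ j) :
    Real.log (c / resolution S) ≤ j * Real.log 2 + resolution S * S * Real.log S := by
  have hlogS : 0 ≤ Real.log S := Real.log_nonneg (by linarith)
  have hdiv : c / resolution S ≤ 2 ^ j * S := by
    rw [resolution, div_div_eq_mul_div, div_one]
    gcongr
    · linarith
    · linarith
  calc Real.log (c / resolution S) ≤ Real.log (2 ^ j * S) :=
        Real.log_le_log (div_pos hc (resolution_pos hS)) hdiv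
    _ = j * Real.log 2 + Real.log S := by
        rw [Real.log_mul (by positivity) (by linarith), Real.log_pow]
    _ ≤ _ := by
        gcongr
        exact le_mul_of_one_le_left hlogS (one_le_resolution_mul hS)

theorem log_one_div_half {δ : ℝ} (hδ : 0 < δ) :
    Real.log (1 / (δ / 2)) = Real.log 2 + Real.log (1 / δ) := by
  rw [← Real.log_mul (by norm_num) (by positivity)]
  ring_nf

theorem le_of_sample_size_le {D m : ℕ} {ε δ : ℝ} (hS : 2 ≤ S) (hε : ε ∈ Set.Ioo (0 : ℝ) 1)
    (hδ : δ ∈ Set.Ioo (0 : ℝ) 1)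
    (hm : 10 * S / ε ^ 2 * (D * Real.log S + Real.log (1 / δ)) ≤ m) : D ≤ m := by
  obtain ⟨hε0, hε1⟩ := hε
  have hlogδ : 0 ≤ Real.log (1 / δ) :=
    Real.log_nonneg (by rw [le_div_iff₀ hδ.1]; linarith [hδ.2])
  have hlogS : 1 / 2 ≤ Real.log S :=
    le_trans (by linarith [Real.log_two_gt_d9]) (Real.log_le_log (by norm_num) hS)
  have hDS : 10 * 2 / 1 * (D * (1 / 2) + 0) ≤
      10 * S / ε ^ 2 * (D * Real.log S + Real.log (1 / δ)) := by
    gcongr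
    exact pow_le_one₀ hε0.le hε1.le
  exact_mod_cast (by linarith [(D.cast_nonneg : (0 : ℝ) ≤ D)] : (D : ℝ) ≤ m)

variable {ι : Type*} [Fintype ι] [DecidableEq ι] {D : ℕ} {ε δ : ℝ}

theorem tiltedSupBound_of_le_three_tenths [Nonempty ι] (hS : 2 ≤ S) (hD : 1 ≤ D) (hε : 0 < ε)
    (hε_le : ε ≤ 3 / 10) (hδ : δ ∈ Set.Ioo (0 : ℝ) 1)
    (hm : 10 * (D * (resolution S * S * Real.log S) + Real.log (1 / δ)) ≤
      ε ^ 2 * Fintype.card ι * resolution S) :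
    TiltedSupBound ι D ε (1 + ε / 2) (resolution S) (δ / 2) := by
  obtain ⟨hδ0, hδ1⟩ := hδ
  have hν := resolution_pos hS
  refine tiltedSupBound_of_chaining hε hD (by positivity) hν (resolution_le_four hS)
    (by positivity) (by linarith) ?_
  have hD1 : (1 : ℝ) ≤ D := by exact_mod_cast hD
  have hlogδ : 0 ≤ Real.log (1 / δ) := Real.log_nonneg (by rw [le_div_iff₀ hδ0]; linarith)
  have hnum : 6 / 5 * Real.log (6500 / resolution S) + Real.log 2 ≤
      3200 / 529 * (resolution S * S * Real.log S) := by
    have := log_div_resolution_le hS (c := 6500) (j := 13) (by norm_num) (by norm_num)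
    push_cast at this
    linarith [two_mul_log_two_add_one_le hS, Real.log_two_lt_d9]
  have hQ : ε ^ 2 * Fintype.card ι * resolution S / (529 / 400) ≤
      ε ^ 2 * Fintype.card ι * resolution S / (1 + ε / 2) ^ 2 := by
    rw [show (529 / 400 : ℝ) = (23 / 20) ^ 2 by norm_num]
    gcongr
    linarith
  rw [log_one_div_half hδ0]
  have hDnum := mul_le_mul_of_nonneg_left hnum (zero_le_one.trans hD1)
  have hDlog : Real.log 2 ≤ D * Real.log 2 :=
    le_mul_of_one_le_left (Real.log_nonneg one_le_two) hD1
  linarith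

/-- `log z ≤ z - 1` is applied with `z` scaled so that it costs `1 / 20` of the exponent. -/
theorem log_exp_one_mul_le {D m ε ν : ℝ} (hD : 0 < D) (hm : 0 < m) (hν : 0 < ν)
    (hε : 3 / 10 ≤ ε) : D * Real.log (Real.exp 1 * (2 * m) / D) ≤
      D * Real.log (512 / ν) + ε ^ 2 * m * ν / 20 := by
  have : 0 < ε := by linarith
  set z := ε ^ 2 * m * ν / D / 20 with hz
  have hz0 : 0 < z := by positivity
  have hfactor : Real.exp 1 * (2 * m) / D = Real.exp 1 * (40 / (ε ^ 2 * ν)) * z := by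
    rw [hz]
    field_simp
    norm_num
  have hlog : Real.log (40 / (ε ^ 2 * ν)) ≤ Real.log (512 / ν) := by
    refine Real.log_le_log (by positivity) ?_
    rw [div_le_div_iff₀ (by positivity) hν]
    nlinarith [pow_le_pow_left₀ (by norm_num) hε 2]
  have hDz : ε ^ 2 * m * ν / 20 = D * z := by rw [hz]; field_simp
  rw [hfactor, Real.log_mul (by positivity) hz0.ne', Real.log_mul (by positivity) (by positivity),
    Real.log_exp, hDz, ← mul_add]
  exact mul_le_mul_of_nonneg_left (by linarith [Real.log_le_sub_one_of_pos hz0]) hD.le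

theorem tiltedSupBound_of_three_tenths_le (hS : 2 ≤ S) (hD : 1 ≤ D) (hDι : D ≤ Fintype.card ι)
    (hε : 3 / 10 ≤ ε) (hε1 : ε ≤ 1) (hδ : δ ∈ Set.Ioo (0 : ℝ) 1)
    (hm : 10 * (D * (resolution S * S * Real.log S) + Real.log (1 / δ)) ≤
      ε ^ 2 * Fintype.card ι * resolution S) :
    TiltedSupBound ι D ε (1 + ε / 2) (resolution S) (δ / 2) := by
  obtain ⟨hδ0, hδ1⟩ := hδ
  have hν := resolution_pos hS
  have hD1 : (1 : ℝ) ≤ D := by exact_mod_cast hD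
  have hι : (0 : ℝ) < Fintype.card ι := by exact_mod_cast hD.trans hDι
  have hlogδ : 0 ≤ Real.log (1 / δ) := Real.log_nonneg (by rw [le_div_iff₀ hδ0]; linarith)
  refine tiltedSupBound_of_card (by linarith) (by linarith) hD (by omega) ?_
  have hnum : Real.log (512 / resolution S) + Real.log 2 ≤
      71 / 18 * (resolution S * S * Real.log S) := by
    have := log_div_resolution_le hS (c := 512) (j := 9) (by norm_num) (by norm_num)
    push_cast at this
    linarith [two_mul_log_two_add_one_le hS, Real.log_two_lt_d9]
  have hQ : ε ^ 2 * Fintype.card ι * resolution S / (9 / 4) ≤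
      ε ^ 2 * Fintype.card ι * resolution S / (1 + ε / 2) ^ 2 := by
    rw [show (9 / 4 : ℝ) = (3 / 2) ^ 2 by norm_num]
    gcongr
    linarith
  have hsauer := log_exp_one_mul_le (D := D) (by linarith) hι hν hε
  rw [← Real.log_le_log_iff (by positivity) (by positivity), Real.log_mul (by positivity)
    (by positivity), Real.log_exp, Real.log_pow, ← neg_neg (Real.log (δ / 2)), ← Real.log_inv,
    ← one_div, log_one_div_half hδ0]
  have hDnum := mul_le_mul_of_nonneg_left hnum (zero_le_one.trans hD1)
  have hDlog : Real.log 2 ≤ D * Real.log 2 :=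
    le_mul_of_one_le_left (Real.log_nonneg one_le_two) hD1
  linarith

theorem tiltedSupBound_of_sample_size (hS : 2 ≤ S) (hD : 1 ≤ D) (hε : ε ∈ Set.Ioo (0 : ℝ) 1)
    (hδ : δ ∈ Set.Ioo (0 : ℝ) 1)
    (hm : 10 * S / ε ^ 2 * (D * Real.log S + Real.log (1 / δ)) ≤ Fintype.card ι) :
    TiltedSupBound ι D ε (1 + ε / 2) (resolution S) (δ / 2) := by
  have hDι := le_of_sample_size_le hS hε hδ hm
  obtain ⟨hε0, hε1⟩ := hε
  have hν := resolution_pos hS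
  have hlogδ : 0 ≤ Real.log (1 / δ) :=
    Real.log_nonneg (by rw [le_div_iff₀ hδ.1]; linarith [hδ.2])
  rw [div_mul_eq_mul_div, div_le_iff₀ (by positivity)] at hm
  have hres : 10 * (D * (resolution S * S * Real.log S) + Real.log (1 / δ)) ≤
      ε ^ 2 * Fintype.card ι * resolution S := by
    have hδS := le_mul_of_one_le_left hlogδ (one_le_resolution_mul hS)
    linarith [mul_le_mul_of_nonneg_left hm hν.le]
  rcases le_total ε (3 / 10) with hsmall | hlarge
  · have : Nonempty ι := Fintype.card_pos_iff.1 (hD.trans hDι)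
    exact tiltedSupBound_of_le_three_tenths hS hD hε0 hsmall hδ hres
  · exact tiltedSupBound_of_three_tenths_le hS hD hDι hlarge hε1.le hδ hres

end SampleSize

section LayerCake

variable {ι κ : Type*} [Fintype ι] [Fintype κ] {lo hi : ℝ}

theorem intervalIntegrable_dens_le (v : ι → ℝ) :
    IntervalIntegrable (fun t => (({i | t ≤ v i} : Finset ι).dens : ℝ)) volume lo hi := by
  refine Antitone.intervalIntegrable fun t t' htt' => ?_
  exact_mod_cast dens_le_dens (monotone_filter_right _ fun i _ hi => htt'.trans hi)

theorem integral_dens_le [Nonempty ι] {v : ι → ℝ} (hv : ∀ i, v i ∈ Set.Icc lo hi) :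
    ∫ t in lo..hi, (({i | t ≤ v i} : Finset ι).dens : ℝ) = 𝔼 i, v i - lo := by
  have hdens : ∀ t, (({i | t ≤ v i} : Finset ι).dens : ℝ) =
      (∑ i, {t | t ≤ v i}.indicator (fun _ => 1) t) / Fintype.card ι := fun t => by
    simp [nnratCast_dens, Set.indicator_apply]
  have hint : ∀ i, IntervalIntegrable ({t | t ≤ v i}.indicator fun _ => (1 : ℝ)) volume lo hi :=
    fun i => ⟨intervalIntegrable_const.1.indicator measurableSet_Iic,
      intervalIntegrable_const.2.indicator measurableSet_Iic⟩
  simp_rw [hdens]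
  rw [intervalIntegral.integral_div, intervalIntegral.integral_finsetSum fun i _ => hint i,
    sum_congr rfl fun i _ => intervalIntegral.integral_indicator (hv i)]
  simp only [intervalIntegral.integral_const, smul_eq_mul, mul_one]
  rw [← Fintype.expect_eq_sum_div_card, expect_sub_distrib, Fintype.expect_const]

theorem abs_expect_sub_expect_le_of_superlevel [Nonempty ι] [Nonempty κ] {w : ι → ℝ} {v : κ → ℝ}
    {ε ν : ℝ} (hw : ∀ j, w j ∈ Set.Icc lo hi) (hv : ∀ i, v i ∈ Set.Icc lo hi)
    (h : ∀ t, |(({j | t ≤ w j} : Finset ι).dens : ℝ) - ({i | t ≤ v i} : Finset κ).dens| ≤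
      ε * (ν + ({i | t ≤ v i} : Finset κ).dens)) :
    |𝔼 j, w j - 𝔼 i, v i| ≤ ε * (ν * (hi - lo) + (𝔼 i, v i - lo)) := by
  obtain ⟨i₀⟩ := ‹Nonempty κ›
  have hlohi : lo ≤ hi := (hv i₀).1.trans (hv i₀).2
  calc |𝔼 j, w j - 𝔼 i, v i|
      = |∫ t in lo..hi,
          ((({j | t ≤ w j} : Finset ι).dens : ℝ) - ({i | t ≤ v i} : Finset κ).dens)| := by
        rw [intervalIntegral.integral_sub (intervalIntegrable_dens_le w)
          (intervalIntegrable_dens_le v), integral_dens_le hw, integral_dens_le hv,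
          sub_sub_sub_cancel_right]
    _ ≤ ∫ t in lo..hi, ε * (ν + ({i | t ≤ v i} : Finset κ).dens) := by
      rw [← Real.norm_eq_abs]
      exact intervalIntegral.norm_integral_le_of_norm_le hlohi (.of_forall fun t _ => h t)
          ((intervalIntegrable_const.add (intervalIntegrable_dens_le v)).const_mul ε)
    _ = ε * (ν * (hi - lo) + (𝔼 i, v i - lo)) := by
        rw [intervalIntegral.integral_const_mul, intervalIntegral.integral_add
          intervalIntegrable_const (intervalIntegrable_dens_le v), integral_dens_le hv,
          intervalIntegral.integral_const, smul_eq_mul, mul_comm ν]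

end LayerCake

section VCDim

variable {d n : ℕ}

/-- The loss `ℓ(-y_i β·x_i)` of the `i`-th data point, without its share of the regularizer. -/
noncomputable def RLMInstance.dataLoss (I : RLMInstance d n) (β : EuclideanSpace ℝ (Fin d))
    (i : Fin n) : ℝ :=
  I.loss (-I.y i * inner ℝ β (I.x i))

open scoped Classical in
/-- The superlevel sets of the data losses, over all hypotheses and all thresholds. -/
noncomputable def RLMInstance.lossFamily (I : RLMInstance d n) : Finset (Finset (Fin n)) :=
  {A | ∃ β t, A = ({i | t ≤ I.dataLoss β i} : Finset (Fin n))}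

theorem RLMInstance.mem_lossFamily {I : RLMInstance d n} {A : Finset (Fin n)} :
    A ∈ I.lossFamily ↔ ∃ β t, A = ({i | t ≤ I.dataLoss β i} : Finset (Fin n)) := by
  simp only [lossFamily, mem_filter, mem_univ, true_and]

theorem LossShatters.card_le {loss : ℝ → ℝ} {A : Finset (EuclideanSpace ℝ (Fin d))}
    (hA : LossShatters loss A) {D : ℕ} (hD : lossVCDim d loss ≤ D) : #A ≤ D :=
  Nat.cast_le.1 ((le_iSup₂ (f := fun A (_ : LossShatters loss A) => (#A : ℕ∞)) A hA).trans hD)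

theorem lossShatters_singleton (loss : ℝ → ℝ) (z : EuclideanSpace ℝ (Fin d)) :
    LossShatters loss {z} := by
  intro B _
  by_cases hB : z ∈ B
  · exact ⟨0, loss 0, by simp [hB]⟩
  · exact ⟨0, loss 0 + 1, by simp [hB]⟩

theorem one_le_of_lossVCDim_le {loss : ℝ → ℝ} {D : ℕ} (hD : lossVCDim d loss ≤ D) : 1 ≤ D := by
  simpa using (lossShatters_singleton loss 0).card_le hD

theorem RLMInstance.exists_le_dataLoss_iff {I : RLMInstance d n} {s t : Finset (Fin n)}
    (hs : I.lossFamily.Shatters s) (ht : t ⊆ s) : ∃ β c, ∀ i ∈ s, c ≤ I.dataLoss β i ↔ i ∈ t := by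
  obtain ⟨u, hu, hsu⟩ := hs ht
  obtain ⟨β, c, rfl⟩ := mem_lossFamily.1 hu
  exact ⟨β, c, fun i hi => by simp [← hsu, hi]⟩

theorem RLMInstance.dataLoss_eq_loss_inner (I : RLMInstance d n) (β : EuclideanSpace ℝ (Fin d))
    (i : Fin n) : I.dataLoss β i = I.loss (inner ℝ β (-I.y i • I.x i)) := by
  rw [dataLoss, inner_smul_right]

theorem RLMInstance.injOn_neg_smul_of_shatters {I : RLMInstance d n} {s : Finset (Fin n)}
    (hs : I.lossFamily.Shatters s) : Set.InjOn (fun i => -I.y i • I.x i) s := by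
  intro a ha b hb hab
  obtain ⟨β, c, h⟩ := exists_le_dataLoss_iff hs (singleton_subset_iff.2 ha)
  have hloss : I.dataLoss β a = I.dataLoss β b := by
    simp only [dataLoss_eq_loss_inner] at hab ⊢
    rw [hab]
  have hac := (h a ha).2 (mem_singleton_self a)
  exact (mem_singleton.1 ((h b hb).1 (hloss ▸ hac))).symm

theorem RLMInstance.lossShatters_image_of_shatters [DecidableEq (EuclideanSpace ℝ (Fin d))]
    {I : RLMInstance d n} {s : Finset (Fin n)} (hs : I.lossFamily.Shatters s) :
    LossShatters I.loss (s.image fun i => -I.y i • I.x i) := by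
  intro B _
  obtain ⟨β, c, h⟩ := exists_le_dataLoss_iff hs (filter_subset (fun i => -I.y i • I.x i ∈ B) s)
  refine ⟨β, c, forall_mem_image.2 fun i hi => ?_⟩
  have hiff := h i hi
  rw [dataLoss_eq_loss_inner, mem_filter, and_iff_right hi] at hiff
  exact ⟨hiff.2, fun hn => not_le.1 (mt hiff.1 hn)⟩

theorem RLMInstance.vcDim_lossFamily_le (I : RLMInstance d n) {D : ℕ}
    (hD : lossVCDim d I.loss ≤ D) : I.lossFamily.vcDim ≤ D := by
  classical
  refine Finset.sup_le fun s hs => ?_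
  rw [mem_shatterer] at hs
  rw [← card_image_of_injOn (injOn_neg_smul_of_shatters hs)]
  exact (lossShatters_image_of_shatters hs).card_le hD

end VCDim

section Scaling

variable {d n : ℕ}

theorem RLMInstance.one_le_loss_div_loss_neg (I : RLMInstance d n) {σ : ℝ} (hσ : 0 ≤ σ)
    (hpos : 0 < I.loss (-σ)) : 1 ≤ I.loss σ / I.loss (-σ) :=
  (one_le_div₀ hpos).2 (I.loss_mono (by linarith))

variable [NeZero n]

theorem RLMInstance.div_mul_lam_pos (I : RLMInstance d n) {τ : ℝ} (hτ : 0 < τ) :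
    0 < n / (τ * I.lam) :=
  div_pos (by exact_mod_cast NeZero.pos n) (mul_pos hτ I.lam_pos)

theorem RLMInstance.norm_le_R (I : RLMInstance d n) (i : Fin n) : ‖I.x i‖ ≤ I.R :=
  le_sup' (fun i : Fin n => ‖I.x i‖) (mem_univ i)

theorem RLMInstance.abs_margin_le (I : RLMInstance d n) (i : Fin n)
    (β : EuclideanSpace ℝ (Fin d)) : |-I.y i * inner ℝ β (I.x i)| ≤ ‖I.R • β‖ := by
  have hR : 0 ≤ I.R := (norm_nonneg _).trans (I.norm_le_R i)
  have hy : |-I.y i| = 1 := by rcases I.y_label i with h | h <;> simp [h]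
  rw [abs_mul, hy, one_mul, norm_smul, Real.norm_of_nonneg hR, mul_comm]
  exact (abs_real_inner_le_norm _ _).trans (by gcongr; exact I.norm_le_R i)

theorem RLMInstance.dataLoss_mem_Icc (I : RLMInstance d n) {β : EuclideanSpace ℝ (Fin d)} {b : ℝ}
    (hb : ‖I.R • β‖ ≤ b) (i : Fin n) : I.dataLoss β i ∈ Set.Icc (I.loss (-b)) (I.loss b) := by
  have hmargin := abs_le.1 ((I.abs_margin_le i β).trans hb)
  exact ⟨I.loss_mono hmargin.1, I.loss_mono hmargin.2⟩

theorem mul_sub_le_of_mul_div_sub_one_le {ν lo hi : ℝ} (hlo : 0 < lo)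
    (hν : ν * (hi / lo - 1) ≤ 1) : ν * (hi - lo) ≤ lo := by
  calc ν * (hi - lo) = ν * (hi / lo - 1) * lo := by field_simp
    _ ≤ 1 * lo := by gcongr
    _ = lo := one_mul lo

theorem RLMInstance.mul_loss_le_of_scalingCondition (I : RLMInstance d n) {σ τ ν : ℝ}
    (hτ : 0 < τ) (hscale : ScalingCondition I.loss I.reg σ τ)
    (hν : ν * (n / (τ * I.lam)) ≤ 1) {β : EuclideanSpace ℝ (Fin d)} (hβ : σ ≤ ‖β‖) :
    ν * I.loss ‖β‖ ≤ I.lam * I.reg β / n := by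
  have hn : (0 : ℝ) < n := by exact_mod_cast NeZero.pos n
  have hlam := I.lam_pos
  have hloss := I.loss_nonneg ‖β‖
  calc ν * I.loss ‖β‖ = ν * (n / (τ * I.lam)) * (I.lam * (τ * I.loss ‖β‖) / n) := by field_simp
    _ ≤ 1 * (I.lam * (τ * I.loss ‖β‖) / n) := by gcongr
    _ ≤ I.lam * I.reg β / n := by
        rw [one_mul]
        gcongr
        exact hscale.2 β hβ

theorem RLMInstance.exists_dataLoss_mem_Icc (I : RLMInstance d n) {σ τ ν : ℝ} (hτ : 0 < τ)
    (hscale : ScalingCondition I.loss I.reg σ τ) (hν : 0 ≤ ν)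
    (hνreg : ν * (n / (τ * I.lam)) ≤ 1) (hνloss : ν * (I.loss σ / I.loss (-σ) - 1) ≤ 1)
    (β : EuclideanSpace ℝ (Fin d)) :
    ∃ lo hi : ℝ, (∀ i, I.dataLoss β i ∈ Set.Icc lo hi) ∧
      ν * (hi - lo) ≤ lo + I.lam * I.reg (I.R • β) / n := by
  rcases le_total σ ‖I.R • β‖ with hlarge | hsmall
  · refine ⟨_, _, I.dataLoss_mem_Icc le_rfl, ?_⟩
    have hlo := I.loss_nonneg (-‖I.R • β‖)
    linarith [I.mul_loss_le_of_scalingCondition hτ hscale hνreg hlarge, mul_nonneg hν hlo]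
  · refine ⟨_, _, I.dataLoss_mem_Icc hsmall, ?_⟩
    have hreg : 0 ≤ I.lam * I.reg (I.R • β) / n :=
      div_nonneg (mul_nonneg I.lam_pos.le (I.reg_nonneg _)) n.cast_nonneg
    linarith [mul_sub_le_of_mul_div_sub_one_le hscale.1 hνloss]

end Scaling

section Coreset

variable {d n m : ℕ} [NeZero n]

theorem RLMInstance.expect_f_comp (I : RLMInstance d n) {ι : Type*} [Fintype ι] [Nonempty ι]
    (C : ι → Fin n) (β : EuclideanSpace ℝ (Fin d)) :
    𝔼 j, I.f (C j) β = 𝔼 j, I.dataLoss β (C j) + I.lam * I.reg (I.R • β) / n := by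
  simp only [f, dataLoss, expect_add_distrib, Fintype.expect_const]

theorem RLMInstance.relError_uniform (I : RLMInstance d n) (C : Fin m → Fin n)
    (β : EuclideanSpace ℝ (Fin d)) :
    I.relError C (fun _ => (n : ℝ) / m) β =
      |𝔼 j, I.f (C j) β - 𝔼 i, I.f i β| / 𝔼 i, I.f i β := by
  have hn : (0 : ℝ) < n := by exact_mod_cast NeZero.pos n
  have hsum : ∑ i, I.f i β = n * 𝔼 i, I.f i β := by
    rw [Fintype.expect_eq_sum_div_card, Fintype.card_fin, mul_div_cancel₀ _ hn.ne']
  have hsample : ∑ j, (n : ℝ) / m * I.f (C j) β = n * 𝔼 j, I.f (C j) β := by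
    rw [Fintype.expect_eq_sum_div_card, Fintype.card_fin, ← mul_sum, div_mul_eq_mul_div,
      mul_div_assoc]
  rw [relError, hsum, hsample, ← mul_sub, abs_mul, abs_of_pos hn, mul_div_mul_left _ _ hn.ne',
    abs_sub_comm]

theorem RLMInstance.isCoreset_of_isRelativeApprox [NeZero m] (I : RLMInstance d n) {σ τ ν ε : ℝ}
    (hτ : 0 < τ) (hscale : ScalingCondition I.loss I.reg σ τ) (hν : 0 ≤ ν) (hε : 0 ≤ ε)
    (hνreg : ν * (n / (τ * I.lam)) ≤ 1) (hνloss : ν * (I.loss σ / I.loss (-σ) - 1) ≤ 1)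
    {C : Fin m → Fin n} (hC : IsRelativeApprox I.lossFamily ε ν C) :
    I.IsCoreset ε C (fun _ => (n : ℝ) / m) := by
  refine ⟨fun _ => by positivity, fun β => ?_⟩
  obtain ⟨lo, hi, hmem, hrange⟩ := I.exists_dataLoss_mem_Icc hτ hscale hν hνreg hνloss β
  have hdev := abs_expect_sub_expect_le_of_superlevel (fun j => hmem (C j)) hmem fun t => by
    simpa only [comapFinset_filter] using hC _ (mem_lossFamily.2 ⟨β, t, rfl⟩)
  have hf := I.expect_f_comp id β
  have hF : 0 ≤ 𝔼 i, I.f i β := expect_nonneg fun i _ => add_nonneg (I.loss_nonneg _)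
    (div_nonneg (mul_nonneg I.lam_pos.le (I.reg_nonneg _)) n.cast_nonneg)
  rw [I.relError_uniform]
  refine div_le_of_le_mul₀ hF hε ?_
  simp only [id_eq] at hf
  rw [I.expect_f_comp C, hf, add_sub_add_right_eq_sub]
  exact hdev.trans (mul_le_mul_of_nonneg_left (by linarith) hε)

end Coreset

section UniformSample

variable {n m : ℕ} [NeZero n]

theorem uniformSample_singleton (C : Fin m → Fin n) :
    uniformSample n m {C} = ((n : ENNReal)⁻¹) ^ m := by
  rw [uniformSample, Measure.pi_singleton]
  simp [PMF.uniformOfFintype_apply]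

theorem uniformSample_coe (s : Finset (Fin m → Fin n)) :
    uniformSample n m s = ENNReal.ofReal s.dens := by
  have hn : (0 : ℝ) < n := by exact_mod_cast NeZero.pos n
  rw [← sum_measure_singleton, nnratCast_dens]
  simp only [uniformSample_singleton, sum_const, nsmul_eq_mul, Fintype.card_pi, Fintype.card_fin,
    prod_const, card_univ, Nat.cast_pow]
  rw [ENNReal.ofReal_div_of_pos (by positivity), ENNReal.ofReal_natCast,
    ENNReal.ofReal_pow hn.le, ENNReal.ofReal_natCast, div_eq_mul_inv, ENNReal.inv_pow]

theorem ofReal_one_sub_le_uniformSample {P : Set (Fin m → Fin n)} {δ : ℝ}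
    (h : ∀ B : Finset (Fin m → Fin n), (∀ C ∈ B, C ∉ P) → (B.dens : ℝ) ≤ δ) :
    ENNReal.ofReal (1 - δ) ≤ uniformSample n m P := by
  classical
  have hB := h {C | C ∉ P} fun C hC => (mem_filter.1 hC).2
  have hsum : ((univ.filter (· ∈ P)).dens : ℝ) + (univ.filter (· ∉ P)).dens = 1 := by
    exact_mod_cast (dens_filter_add_dens_filter_not_eq_dens _).trans dens_univ
  calc ENNReal.ofReal (1 - δ) ≤ ENNReal.ofReal (univ.filter (· ∈ P)).dens := by
        gcongr
        linarith
    _ = uniformSample n m P := by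
        rw [← uniformSample_coe, coe_filter_univ, Set.ofPred_mem_eq]

end UniformSample

theorem mainTheorem1 {d n : ℕ} [NeZero n] (I : RLMInstance d n) (σ τ : ℝ)
    (hσ : 0 ≤ σ) (hτ : 0 < τ) (hscale : ScalingCondition I.loss I.reg σ τ)
    (Δ : ℕ) (hΔ : lossVCDim d I.loss ≤ (Δ : ℕ∞))
    (ε δ : ℝ) (hε : ε ∈ Set.Ioo (0 : ℝ) 1) (hδ : δ ∈ Set.Ioo (0 : ℝ) 1)
    (S' : ℝ) (hS' : S' = n / (τ * I.lam) + I.loss σ / I.loss (-σ) + 1)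
    (m : ℕ) (hm : 10 * S' / ε ^ 2 * (Δ * Real.log S' + Real.log (1 / δ)) ≤ m) :
    ENNReal.ofReal (1 - δ) ≤
      uniformSample n m {C | I.IsCoreset ε C (fun _ => (n : ℝ) / m)} := by
  have hΔ1 : 1 ≤ Δ := one_le_of_lossVCDim_le hΔ
  have hreg := I.div_mul_lam_pos hτ
  have hloss := I.one_le_loss_div_loss_neg hσ hscale.1
  have hS : 2 ≤ S' := by linarith
  have hν := resolution_pos hS
  have hνS := resolution_mul_sub_two_le hS
  have hνreg : resolution S' * (n / (τ * I.lam)) ≤ 1 := by nlinarith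
  have hνloss : resolution S' * (I.loss σ / I.loss (-σ) - 1) ≤ 1 := by nlinarith
  have : NeZero m := .of_pos (hΔ1.trans (le_of_sample_size_le hS hε hδ hm))
  have hsup : TiltedSupBound (Fin m) Δ ε (1 + ε / 2) (resolution S') (δ / 2) :=
    tiltedSupBound_of_sample_size hS hΔ1 hε hδ (by rwa [Fintype.card_fin])
  refine ofReal_one_sub_le_uniformSample fun B hB => ?_
  refine (hsup.dens_not_isRelativeApprox_le hε.1.le (I.vcDim_lossFamily_le hΔ) fun C hC happrox =>
    hB C hC ?_).trans_eq (by ring)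
  exact I.isCoreset_of_isRelativeApprox hτ hscale hν.le hε.1.le hνreg hνloss happrox
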